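/- Let $\mathbb A$ be a finite alphabet. Forests over $\mathbb A$ are finite ordered unranked $\mathbb A$-labelled forests (the empty forest $0$ included); a context is a forest in which one leaf is replaced by a hole $\Box$ (the hole may be at the top level, and $\Box$ itself is the empty context); a tree is a forest with exactly one root; a tree-context is a nonempty context with a node that is an ancestor of all other nodes, including the hole. For forests $s,s'$ write $s\unlhd s'$ ($s$ is a cca-piece of $s'$) for the reflexive transitive closure of the relation $\{(pt,pat): p \text{ a context},\ a\in\mathbb A,\ t \text{ a tree or empty}\}$; that is, nodes with at most one child may be deleted one after the other. For contexts, $p\unlhd q$ is defined in the same way, where the hole counts as a leaf with its own label, which has to be preserved. A forest language $L$ is cca-piecewise testable if there is an $n>0$ such that membership of a forest $t$ in $L$ depends only on the set of cca-pieces of $t$ with at most $n$ nodes. Let $(H_L,V_L)$ be the syntactic forest algebra of $L$: $H_L$ is the quotient of the monoid of forests by $s\sim s'\iff(\forall\text{ contexts }p:\ ps\in L\Leftrightarrow ps'\in L)$, and $V_L$ is the quotient of the monoid of contexts by $p\sim p'\iff(\forall\text{ forests }s:\ ps\sim p's)$; let $\alpha_L$ be the projection (the syntactic morphism). A tree-type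 is the image under $\alpha_L$ of a tree, a tree-context-type is the image of a tree-context, and $x\unlhd y$ in $H_L$ (in $V_L$) means that $x,y$ are the images of forests (contexts) $s\unlhd t$. Theorem. A forest language $L$ over $\mathbb A$ is cca-piecewise testable if and only if $H_L$ and $V_L$ are finite (that is, $L$ is regular) and, with $\omega>0$ such that $v^\omega$ is idempotent for all $v\in V_L$ and $\omega\cdot h$ is idempotent for all $h\in H_L$, 1. $u^\omega h=u^\omega v h=v u^\omega h$ for all tree-context-types $u,v\in V_L$ with $v\unlhd u$ and all $h\in H_L$ such that $h$ is a tree-type or $h=0$ (the type of the empty forest); and 2. $\omega\cdot h=\omega\cdot h+g=g+\omega\cdot h$ for all $g,h\in H_L$ with $g\unlhd h$. -/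

import Mathlib

/-- Finite ordered unranked forests with node labels in `A`: a forest is either the empty forest
or `a(children) + rest`, with first tree `a(children)`. -/
inductive Forest (A : Type*) : Type _
  | nil : Forest A
  | cons (a : A) (children rest : Forest A) : Forest A

namespace Forest

variable {A B : Type*}

/-- Concatenation `s + t` of forests. -/
def append : Forest A → Forest A → Forest A
  | nil, t => t
  | cons a c s, t => cons a c (append s t)

theorem append_nil (s : Forest A) : append s nil = s := by
  induction s with
  | nil => rfl
  | cons a c s _ ih => simp [append, ih]

theorem append_assoc (s t u : Forest A) :
    append (append s t) u = append s (append t u) := by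
  induction s with
  | nil => rfl
  | cons a c s _ ih => simp [append, ih]

/-- The empty forest. -/
instance : Zero (Forest A) := ⟨nil⟩

instance : Add (Forest A) := ⟨append⟩

/-- Forests form a monoid under concatenation. -/
instance : AddMonoid (Forest A) where
  zero_add _ := rfl
  add_zero := append_nil
  add_assoc := append_assoc
  nsmul := nsmulRec

/-- The tree `a s` with root label `a` and with the forest `s` below the root. -/
def tree (a : A) (s : Forest A) : Forest A := cons a s nil

/-- A forest is a tree if it has exactly one root. -/
def IsTree (s : Forest A) : Prop := ∃ (a : A) (c : Forest A), s = tree a c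

/-- The number of nodes. -/
def size : Forest A → ℕ
  | nil => 0
  | cons _ c s => 1 + size c + size s

/-- Relabelling. -/
def map (f : A → B) : Forest A → Forest B
  | nil => nil
  | cons a c s => cons (f a) (map f c) (map f s)

end Forest

/-- Contexts over `A`: forests in which one leaf is replaced by a hole `□`. Every context is in a
unique way `l + □ + r` (constructor `hole`) or `l + a(p) + r` with a context `p`
(constructor `node`). -/
inductive ForestContext (A : Type*) : Type _
  | hole (l r : Forest A) : ForestContext A
  | node (l : Forest A) (a : A) (p : ForestContext A) (r : Forest A) : ForestContext A

namespace ForestContext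

variable {A : Type*}

/-- `p.fill s` substitutes the forest `s` for the hole of `p`. -/
def fill : ForestContext A → Forest A → Forest A
  | hole l r, s => l + s + r
  | node l a p r, s => l + Forest.tree a (p.fill s) + r

/-- The context `l + p + r`. -/
def surround (l : Forest A) : ForestContext A → Forest A → ForestContext A
  | hole l' r', r => hole (l + l') (r' + r)
  | node l' a p r', r => node (l + l') a p (r' + r)

/-- `p.comp q` substitutes the context `q` for the hole of `p`. -/
def comp : ForestContext A → ForestContext A → ForestContext A
  | hole l r, q => surround l q r
  | node l a p r, q => node l a (p.comp q) r

theorem surround_fill (l r s : Forest A) (q : ForestContext A) :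
    (surround l q r).fill s = l + q.fill s + r := by
  cases q <;> simp [surround, fill, add_assoc]

theorem comp_fill (p q : ForestContext A) (s : Forest A) :
    (p.comp q).fill s = p.fill (q.fill s) := by
  induction p with
  | hole l r => simp [comp, fill, surround_fill]
  | node l a p r ih => simp [comp, fill, ih]

theorem surround_comp (l r : Forest A) (p q : ForestContext A) :
    (surround l p r).comp q = surround l (p.comp q) r := by
  cases p with
  | hole l' r' => cases q <;> simp [surround, comp, add_assoc]
  | node l' a p r' => simp [surround, comp]

theorem comp_assoc (p q r : ForestContext A) : (p.comp q).comp r = p.comp (q.comp r) := by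
  induction p with
  | hole l r' => simp [comp, surround_comp]
  | node l a p r' ih => simp [comp, ih]

/-- Contexts form a monoid under composition; `1` is the empty context `□`. -/
instance : Monoid (ForestContext A) where
  one := hole 0 0
  mul := comp
  one_mul p := by
    change comp (hole 0 0) p = p
    cases p <;> simp [comp, surround]
  mul_one p := by
    change comp p (hole 0 0) = p
    induction p with
    | hole l r => simp [comp, surround]
    | node l a p r ih => simp [comp, ih]
  mul_assoc := comp_assoc

/-- Contexts act on forests by substitution. -/
instance : MulAction (ForestContext A) (Forest A) where
  smul := fill
  one_smul s := by
    change fill (hole 0 0) s = s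
    simp [fill]
  mul_smul p q s := comp_fill p q s

/-- A tree-context has a node that is an ancestor of all other nodes, including the hole. -/
def IsTreeContext (p : ForestContext A) : Prop :=
  ∃ (a : A) (q : ForestContext A), p = node 0 a q 0

/-- The context as a forest over `A ∪ {□}`, in which the hole is a leaf labelled `□ = none`. -/
def markHole : ForestContext A → Forest (Option A)
  | hole l r => l.map some + Forest.tree none 0 + r.map some
  | node l a p r => l.map some + Forest.tree (some a) p.markHole + r.map some

end ForestContext

section CcaPieces

variable {A : Type*}

/-- One deletion step: `CcaStep s s'` says that `s = p t` and `s' = p a t`, for some context `p`,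
some label `a` and some `t` that is a tree or empty. -/
def CcaStep (s s' : Forest A) : Prop :=
  ∃ (p : ForestContext A) (a : A) (t : Forest A),
    (t = 0 ∨ t.IsTree) ∧ s = p • t ∧ s' = p • Forest.tree a t

/-- `s` is a cca-piece of `s'`. -/
def CcaPiece (s s' : Forest A) : Prop := Relation.ReflTransGen CcaStep s s'

/-- The context `p` is a cca-piece of the context `q`: the hole counts as a leaf of its own label,
and has to be preserved. -/
def ContextCcaPiece (p q : ForestContext A) : Prop := CcaPiece p.markHole q.markHole

/-- For some `n`, membership of a forest in `L` depends only on the set of its cca-pieces with at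
most `n` nodes. -/
def IsCcaPiecewiseTestable (L : Set (Forest A)) : Prop :=
  ∃ n : ℕ, 0 < n ∧ ∀ s t : Forest A,
    {r | r.size ≤ n ∧ CcaPiece r s} = {r | r.size ≤ n ∧ CcaPiece r t} → (s ∈ L ↔ t ∈ L)

end CcaPieces

section SyntacticAlgebra

variable {A : Type*}

/-- The syntactic equivalence of forests: `s ∼ s'` iff `p s ∈ L ↔ p s' ∈ L` for all contexts
`p`. -/
def SynRel (L : Set (Forest A)) (s s' : Forest A) : Prop :=
  ∀ p : ForestContext A, p • s ∈ L ↔ p • s' ∈ L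

theorem SynRel.smul {L : Set (Forest A)} {s s' : Forest A} (h : SynRel L s s')
    (q : ForestContext A) : SynRel L (q • s) (q • s') := by
  intro p
  rw [← mul_smul, ← mul_smul]
  exact h (p * q)

theorem SynRel.trans {L : Set (Forest A)} {s t u : Forest A} (h : SynRel L s t)
    (h' : SynRel L t u) : SynRel L s u := fun p => (h p).trans (h' p)

/-- The syntactic congruence on forests. -/
def synAddCon (L : Set (Forest A)) : AddCon (Forest A) where
  r := SynRel L
  iseqv := ⟨fun _ _ => Iff.rfl, fun h p => (h p).symm, SynRel.trans⟩
  add' := by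
    intro s s' t t' hs ht
    have h1 : SynRel L (s + t) (s' + t) := by
      have := hs.smul (ForestContext.hole 0 t)
      simpa [HSMul.hSMul, SMul.smul, ForestContext.fill] using this
    have h2 : SynRel L (s' + t) (s' + t') := by
      have := ht.smul (ForestContext.hole s' 0)
      simpa [HSMul.hSMul, SMul.smul, ForestContext.fill] using this
    exact h1.trans h2

/-- The syntactic congruence on contexts: `p ∼ p'` iff `p s ∼ p' s` for all forests `s`. -/
def synCon (L : Set (Forest A)) : Con (ForestContext A) where
  r p p' := ∀ s : Forest A, SynRel L (p • s) (p' • s)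
  iseqv := ⟨fun _ _ _ => Iff.rfl, fun h s p => (h s p).symm, fun h h' s => (h s).trans (h' s)⟩
  mul' := by
    intro p p' q q' hp hq s
    rw [mul_smul, mul_smul]
    exact ((hq s).smul p).trans (hp (q' • s))

/-- The horizontal monoid `H_L` of the syntactic forest algebra. -/
abbrev SynH (L : Set (Forest A)) : Type _ := (synAddCon L).Quotient

/-- The vertical monoid `V_L` of the syntactic forest algebra. -/
abbrev SynV (L : Set (Forest A)) : Type _ := (synCon L).Quotient

/-- The syntactic morphism on forests. -/
def forestType (L : Set (Forest A)) (s : Forest A) : SynH L := (s : (synAddCon L).Quotient)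

/-- The syntactic morphism on contexts. -/
def contextType (L : Set (Forest A)) (p : ForestContext A) : SynV L := (p : (synCon L).Quotient)

/-- The action of `V_L` on `H_L`, induced by substitution. -/
instance (L : Set (Forest A)) : MulAction (SynV L) (SynH L) where
  smul := Quotient.map₂ (fun p s => p • s) (by
    intro p p' hp s s' hs
    exact SynRel.trans (SynRel.smul hs p) (hp s'))
  one_smul := by
    rintro ⟨s⟩
    exact congrArg (forestType L) (one_smul (ForestContext A) s)
  mul_smul := by
    rintro ⟨p⟩ ⟨q⟩ ⟨s⟩
    exact congrArg (forestType L) (mul_smul p q s)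

/-- The syntactic morphism is compatible with the actions. -/
theorem contextType_smul_forestType (L : Set (Forest A)) (p : ForestContext A) (s : Forest A) :
    contextType L p • forestType L s = forestType L (p • s) := rfl

/-- `h` is the type of a tree. -/
def IsTreeType (L : Set (Forest A)) (h : SynH L) : Prop :=
  ∃ t : Forest A, t.IsTree ∧ forestType L t = h

/-- `v` is the type of a tree-context. -/
def IsTreeContextType (L : Set (Forest A)) (v : SynV L) : Prop :=
  ∃ p : ForestContext A, p.IsTreeContext ∧ contextType L p = v

/-- `g ⊴ h` in `H_L`, relative to the syntactic morphism. -/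
def TypeCcaPiece (L : Set (Forest A)) (g h : SynH L) : Prop :=
  ∃ s t : Forest A, CcaPiece s t ∧ forestType L s = g ∧ forestType L t = h

/-- `v ⊴ w` in `V_L`, relative to the syntactic morphism. -/
def ContextTypeCcaPiece (L : Set (Forest A)) (v w : SynV L) : Prop :=
  ∃ p q : ForestContext A, ContextCcaPiece p q ∧ contextType L p = v ∧ contextType L q = w

/-- `ω > 0` is such that all powers `v ^ ω` in `V_L` and all multiples `ω • h` in `H_L` are
idempotent. In a finite algebra such an `ω` exists, and `v ^ ω` and `ω • h` do not depend on its
choice. -/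
def IsIdempotentExponent (L : Set (Forest A)) (ω : ℕ) : Prop :=
  0 < ω ∧ (∀ v : SynV L, v ^ ω * v ^ ω = v ^ ω) ∧ (∀ h : SynH L, ω • h + ω • h = ω • h)

end SyntacticAlgebra

/-! Deleting nodes with at most one child generates homeomorphic embedding (`ccaPiece_iff_le`), a
well-quasi-order by Kruskal's theorem. Both directions thereby become statements about monotone
sequences of forests.

Suppose that the pieces with at most `n` nodes determine `L`. They then determine syntactic types,
and along a monotone sequence the set of small pieces grows inside a finite set. So the types
stabilise, also for forests squeezed between members of the sequence. The identities follow by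
sandwiching, for instance `k • t ≤ k • t + s ≤ (k + 1) • t` when `s ≤ t`.

Conversely, the identities force the types along every monotone sequence to stabilise
(`eventuallyConstType_of_monotone`). This suffices, because a language that is not testable yields a
monotone sequence alternating between `L` and its complement. To prove it, call a monotone sequence
bad if its types do not stabilise. A region of a sequence consists of subforests whose surrounding
contexts also grow with time. Every bad sequence has a minimal bad region (`IsBad.exists_minimal`),
obtained as the limit of a greedy descent. The limit stays bad for the following reason: the lower
sets of contexts removed from stage `k` on stabilise by well-quasi-order, the stable set is a
submonoid, and the identities provide in it a context `e` that absorbs all others and has the type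
of every sufficiently large one (`IsLowerSubmonoid.exists_absorbing`). The types at some stage are
thus those of `e` applied to the limit. The minimality argument runs once with the contexts `l + □ +
r`, which reduces to sequences of trees, and once with tree-contexts. A minimal bad sequence of
trees either keeps its root from some time on, and then the forests of children have a bad
component; or it is pushed below a new root infinitely often, and then a nontrivial context acting
like a fixed `e` can be peeled off, leaving a bad region. Both contradict minimality. -/

namespace Forest

variable {A B : Type*}

/-! ### Forests and homeomorphic embedding. -/

theorem nil_eq_zero : (nil : Forest A) = 0 := rfl

theorem cons_add (a : A) (c s t : Forest A) : cons a c s + t = cons a c (s + t) := rfl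

theorem cons_eq_tree_add (a : A) (c s : Forest A) : cons a c s = tree a c + s := rfl

theorem tree_ne_zero (a : A) (c : Forest A) : tree a c ≠ 0 := nofun

theorem IsTree.ne_zero {s : Forest A} : s.IsTree → s ≠ 0 := by
  rintro ⟨a, c, rfl⟩
  exact tree_ne_zero a c

theorem isTree_tree (a : A) (c : Forest A) : (tree a c).IsTree := ⟨a, c, rfl⟩

theorem add_eq_zero {s t : Forest A} : s + t = 0 ↔ s = 0 ∧ t = 0 := by
  cases s with
  | nil => simp [nil_eq_zero]
  | cons a c s => exact ⟨nofun, nofun⟩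

theorem add_eq_tree {s t : Forest A} {a : A} {c : Forest A} (h : s + t = tree a c) :
    (s = 0 ∧ t = tree a c) ∨ (s = tree a c ∧ t = 0) := by
  cases s with
  | nil => exact Or.inl ⟨rfl, by simpa [nil_eq_zero] using h⟩
  | cons b d s =>
    obtain ⟨rfl, rfl, h'⟩ := (cons.injEq ..).mp (show cons b d (s + t) = cons a c nil from h)
    obtain ⟨rfl, rfl⟩ := add_eq_zero.mp h'
    exact Or.inr ⟨rfl, rfl⟩

/-- The forest is a tree or empty. -/
def IsTreeOrZero (s : Forest A) : Prop := s = 0 ∨ s.IsTree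

@[simp] theorem size_zero : size (0 : Forest A) = 0 := rfl

@[simp] theorem size_tree (a : A) (c : Forest A) : size (tree a c) = 1 + size c := rfl

@[simp] theorem size_add (s t : Forest A) : size (s + t) = size s + size t := by
  induction s with
  | nil => simp [nil_eq_zero]
  | cons a c s _ ih => rw [cons_add, size, size, ih]; ring

theorem size_eq_zero {s : Forest A} : size s = 0 ↔ s = 0 := by
  cases s with
  | nil => simp [nil_eq_zero]
  | cons a c s => simp [size, cons_eq_tree_add, add_eq_zero, tree_ne_zero]

@[simp] theorem map_zero (f : A → B) : map f (0 : Forest A) = 0 := rfl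

@[simp] theorem map_tree (f : A → B) (a : A) (c : Forest A) :
    map f (tree a c) = tree (f a) (map f c) := rfl

@[simp] theorem map_add (f : A → B) (s t : Forest A) : map f (s + t) = map f s + map f t := by
  induction s with
  | nil => rfl
  | cons a c s _ ih => rw [cons_add, map, map, ih, cons_add]

theorem map_injective {f : A → B} (hf : f.Injective) : (map f).Injective := by
  intro s
  induction s with
  | nil => intro t h; cases t <;> simp_all [map]
  | cons a c s ihc ihs =>
    intro t h
    cases t with
    | nil => simp [map] at h
    | cons b d t =>
      simp only [map, cons.injEq] at h
      rw [hf h.1, ihc h.2.1, ihs h.2.2]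

/-- Homeomorphic embedding of forests, defined structurally. -/
inductive Emb : Forest A → Forest A → Prop
  | nil (t : Forest A) : Emb nil t
  | skip (a : A) (c : Forest A) {s t : Forest A} : Emb s t → Emb s (cons a c t)
  | cons (a : A) {c c' s s' : Forest A} : Emb c c' → Emb s s' → Emb (cons a c s) (cons a c' s')
  | dig (a b : A) {c c' s s' : Forest A} :
      Emb (cons a c nil) c' → Emb s s' → Emb (cons a c s) (cons b c' s')

theorem Emb.refl (s : Forest A) : Emb s s := by
  induction s with
  | nil => exact .nil _
  | cons a c s ihc ihs => exact .cons a ihc ihs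

theorem Emb.trans {s t u : Forest A} (h : Emb s t) (h' : Emb t u) : Emb s u := by
  induction h' generalizing s with
  | nil t => cases h; exact .nil _
  | skip a c _ ih => exact .skip a c (ih h)
  | cons a _ _ ih1 ih2 =>
    cases h with
    | nil => exact .nil _
    | skip _ _ h => exact .skip _ _ (ih2 h)
    | cons _ h1 h2 => exact .cons a (ih1 h1) (ih2 h2)
    | dig b _ h1 h2 => exact .dig b a (ih1 h1) (ih2 h2)
  | dig a b _ _ ih1 ih2 =>
    cases h with
    | nil => exact .nil _
    | skip _ _ h => exact .skip _ _ (ih2 h)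
    | cons _ h1 h2 => exact .dig a b (ih1 (.cons a h1 (.nil _))) (ih2 h2)
    | dig d _ h1 h2 => exact .dig d b (ih1 (.dig d a h1 (.nil _))) (ih2 h2)

/-- Forests are preordered by homeomorphic embedding. -/
instance : Preorder (Forest A) where
  le := Emb
  le_refl := Emb.refl
  le_trans _ _ _ := Emb.trans

theorem zero_le (s : Forest A) : 0 ≤ s := Emb.nil s

theorem le_zero {s : Forest A} : s ≤ 0 ↔ s = 0 := by
  refine ⟨fun h => ?_, fun h => h ▸ le_rfl⟩
  cases (h : Emb s nil); rfl

theorem add_le_add {s s' t t' : Forest A} (h : s ≤ s') (h' : t ≤ t') : s + t ≤ s' + t' := by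
  change Emb s s' at h
  induction h with
  | nil u =>
    induction u with
    | nil => exact h'
    | cons a c u _ ih => exact Emb.skip a c ih
  | skip a c _ ih => exact Emb.skip a c ih
  | cons a h1 _ _ ih => exact Emb.cons a h1 ih
  | dig a b h1 _ _ ih => exact Emb.dig a b h1 ih

theorem le_add_right (s t : Forest A) : s ≤ s + t := by
  simpa using add_le_add (le_refl s) (zero_le t)

theorem le_add_left (s t : Forest A) : t ≤ s + t := by
  simpa using add_le_add (zero_le s) (le_refl t)

theorem tree_le_tree (a : A) {c c' : Forest A} (h : c ≤ c') : tree a c ≤ tree a c' :=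
  Emb.cons a h (.nil _)

/-- A new root may be put only above a tree or the empty forest, just as only nodes with at most one
child may be deleted. Every later restriction to trees or `0` comes from here. -/
theorem IsTreeOrZero.le_tree {s c : Forest A} (hs : s.IsTreeOrZero) (b : A) (h : s ≤ c) :
    s ≤ tree b c := by
  rcases hs with rfl | ⟨a, d, rfl⟩
  · exact zero_le _
  · exact Emb.dig a b h (.nil _)

/-- A forest embeds in a tree iff it is empty, or is a tree embedded with or without the root. -/
theorem le_tree_cases {s c : Forest A} {b : A} (h : s ≤ tree b c) :
    s = 0 ∨ (∃ d, s = tree b d ∧ d ≤ c) ∨ (s.IsTree ∧ s ≤ c) := by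
  cases (h : Emb s (cons b c nil)) with
  | nil => exact Or.inl rfl
  | skip _ _ h => exact Or.inl (le_zero.mp h)
  | cons _ h1 h2 =>
    obtain rfl := le_zero.mp h2
    exact Or.inr (Or.inl ⟨_, rfl, h1⟩)
  | dig a _ h1 h2 =>
    obtain rfl := le_zero.mp h2
    exact Or.inr (Or.inr ⟨⟨_, _, rfl⟩, h1⟩)

theorem IsTreeOrZero.of_le {s t : Forest A} (ht : t.IsTreeOrZero) (h : s ≤ t) :
    s.IsTreeOrZero := by
  rcases ht with rfl | ⟨a, d, rfl⟩
  · exact Or.inl (le_zero.mp h)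
  · rcases le_tree_cases h with h | ⟨d, rfl, -⟩ | h
    · exact Or.inl h
    · exact Or.inr ⟨_, _, rfl⟩
    · exact Or.inr h.1

theorem exists_of_le_add {w s t : Forest A} (h : w ≤ s + t) :
    ∃ w1 w2, w = w1 + w2 ∧ w1 ≤ s ∧ w2 ≤ t := by
  induction s generalizing w with
  | nil => exact ⟨0, w, rfl, le_rfl, h⟩
  | cons b d s _ ih =>
    cases (h : Emb w (cons b d (s + t))) with
    | nil => exact ⟨0, 0, rfl, zero_le _, zero_le _⟩
    | skip _ _ h =>
      obtain ⟨w1, w2, rfl, h1, h2⟩ := ih h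
      exact ⟨w1, w2, rfl, .skip _ _ h1, h2⟩
    | cons _ h1 h2 =>
      obtain ⟨w1, w2, rfl, h3, h4⟩ := ih h2
      exact ⟨_, w2, rfl, .cons b h1 h3, h4⟩
    | dig a _ h1 h2 =>
      obtain ⟨w1, w2, rfl, h3, h4⟩ := ih h2
      exact ⟨_, w2, rfl, .dig a b h1 h3, h4⟩

/-- Splittings propagate upwards along embeddings, as they propagate downwards by
`exists_of_le_add`. Together the two carry a splitting at one time along a whole monotone sequence.
-/
theorem exists_of_add_le {w s t : Forest A} (h : s + t ≤ w) :
    ∃ w1 w2, w = w1 + w2 ∧ s ≤ w1 ∧ t ≤ w2 := by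
  induction w generalizing s with
  | nil =>
    obtain ⟨rfl, rfl⟩ := add_eq_zero.mp (le_zero.mp h)
    exact ⟨0, 0, rfl, le_rfl, le_rfl⟩
  | cons b d w _ ih =>
    cases s with
    | nil => exact ⟨0, _, rfl, le_rfl, h⟩
    | cons a c s =>
      cases (h : Emb (cons a c (s + t)) _) with
      | skip _ _ h =>
        obtain ⟨w1, w2, rfl, h1, h2⟩ := ih (s := cons a c s) h
        exact ⟨cons b d w1, w2, rfl, .skip _ _ h1, h2⟩
      | cons _ h1 h2 =>
        obtain ⟨w1, w2, rfl, h3, h4⟩ := ih h2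
        exact ⟨_, w2, rfl, .cons _ h1 h3, h4⟩
      | dig _ _ h1 h2 =>
        obtain ⟨w1, w2, rfl, h3, h4⟩ := ih h2
        exact ⟨_, w2, rfl, .dig a b h1 h3, h4⟩

theorem IsTreeOrZero.le_add_cases {s t u : Forest A} (hs : s.IsTreeOrZero) (h : s ≤ t + u) :
    s ≤ t ∨ s ≤ u := by
  obtain ⟨w1, w2, rfl, h1, h2⟩ := exists_of_le_add h
  rcases hs with hs | ⟨a, c, hs⟩
  · rw [hs]; exact Or.inl (zero_le _)
  · rcases add_eq_tree hs with ⟨rfl, -⟩ | ⟨-, rfl⟩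
    · exact Or.inr (by simpa using h2)
    · exact Or.inl (by simpa using h1)

theorem map_le_map (f : A → B) {s t : Forest A} (h : s ≤ t) : map f s ≤ map f t := by
  change Emb s t at h
  induction h with
  | nil => exact .nil _
  | skip a c _ ih => exact .skip _ _ ih
  | cons a _ _ ih1 ih2 => exact .cons _ ih1 ih2
  | dig a b _ _ ih1 ih2 => exact .dig _ _ ih1 ih2

theorem exists_of_le_map {f : A → B} {w : Forest B} {s : Forest A} (h : w ≤ map f s) :
    ∃ t, w = map f t ∧ t ≤ s := by
  induction s generalizing w with
  | nil => exact ⟨0, le_zero.mp h, le_rfl⟩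
  | cons a c s ihc ihs =>
    cases (h : Emb w (cons (f a) (map f c) (map f s))) with
    | nil => exact ⟨0, rfl, zero_le _⟩
    | skip _ _ h =>
      obtain ⟨t, rfl, ht⟩ := ihs h
      exact ⟨t, rfl, .skip _ _ ht⟩
    | cons _ h1 h2 =>
      obtain ⟨t, rfl, ht⟩ := ihs h2
      obtain ⟨d, rfl, hd⟩ := ihc h1
      exact ⟨cons a d t, rfl, .cons _ hd ht⟩
    | dig b _ h1 h2 =>
      obtain ⟨t, rfl, ht⟩ := ihs h2
      obtain ⟨d, hd', hd⟩ := ihc h1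
      cases d with
      | nil => simp [map] at hd'
      | cons e d d' =>
        simp only [map, cons.injEq] at hd'
        obtain ⟨rfl, rfl, hd'⟩ := hd'
        cases d' with
        | cons => simp [map] at hd'
        | nil => exact ⟨cons e d t, rfl, .dig _ _ hd ht⟩

end Forest

namespace ForestContext

variable {A : Type*}

theorem hole_smul (l r s : Forest A) : hole l r • s = l + s + r := rfl

theorem node_smul (l r : Forest A) (a : A) (p : ForestContext A) (s : Forest A) :
    node l a p r • s = l + Forest.tree a (p • s) + r := rfl

theorem smul_le_smul_right (p : ForestContext A) {s t : Forest A} (h : s ≤ t) :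
    p • s ≤ p • t := by
  induction p with
  | hole l r => exact Forest.add_le_add (Forest.add_le_add le_rfl h) le_rfl
  | node l a p r ih =>
    exact Forest.add_le_add (Forest.add_le_add le_rfl (Forest.tree_le_tree a ih)) le_rfl

end ForestContext

/-! ### Cca-pieces are homeomorphic embeddings. -/

section CcaPiece

variable {A : Type*}

theorem CcaStep.le {s t : Forest A} (h : CcaStep s t) : s ≤ t := by
  obtain ⟨p, a, t, ht, rfl, rfl⟩ := h
  exact p.smul_le_smul_right (Forest.IsTreeOrZero.le_tree ht a le_rfl)

theorem CcaStep.smul {s t : Forest A} (h : CcaStep s t) (q : ForestContext A) :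
    CcaStep (q • s) (q • t) := by
  obtain ⟨p, a, t, ht, rfl, rfl⟩ := h
  exact ⟨q * p, a, t, ht, (mul_smul ..).symm, (mul_smul ..).symm⟩

theorem CcaPiece.smul {s t : Forest A} (h : CcaPiece s t) (q : ForestContext A) :
    CcaPiece (q • s) (q • t) := by
  induction h with
  | refl => exact .refl
  | tail _ h ih => exact ih.tail (h.smul q)

theorem CcaPiece.add {s s' t t' : Forest A} (h : CcaPiece s s') (h' : CcaPiece t t') :
    CcaPiece (s + t) (s' + t') := by
  have h1 := h.smul (.hole 0 t)
  have h2 := h'.smul (.hole s' 0)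
  simp only [ForestContext.hole_smul, zero_add, add_zero] at h1 h2
  exact h1.trans h2

theorem CcaPiece.tree {s t : Forest A} (h : CcaPiece s t) (a : A) :
    CcaPiece (.tree a s) (.tree a t) := by
  simpa [ForestContext.node_smul, ForestContext.hole_smul] using h.smul (.node 0 a (.hole 0 0) 0)

theorem CcaPiece.tree_of_isTree {t : Forest A} (ht : t = 0 ∨ t.IsTree) (a : A) :
    CcaPiece t (.tree a t) :=
  .single ⟨1, a, t, ht, (one_smul ..).symm, (one_smul ..).symm⟩

theorem CcaPiece.zero_left (s : Forest A) : CcaPiece 0 s := by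
  induction s with
  | nil => exact .refl
  | cons a c s ihc ihs =>
    exact CcaPiece.add ((CcaPiece.tree_of_isTree (Or.inl rfl) a).trans (ihc.tree a)) ihs

/-- Each constructor of `Emb` is realised by deletions: `skip` erases a tree leaf by leaf, and `dig`
first shrinks the children of the new root to a single tree and then deletes that root. -/
theorem ccaPiece_iff_le {s t : Forest A} : CcaPiece s t ↔ s ≤ t := by
  constructor
  · intro h
    induction h with
    | refl => exact le_rfl
    | tail _ h ih => exact ih.trans h.le
  · intro h
    change Forest.Emb s t at h
    induction h with
    | nil => exact .zero_left _
    | skip a c _ ih => exact (CcaPiece.zero_left (.tree a c)).add ih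
    | cons a _ _ ih1 ih2 => exact (ih1.tree a).add ih2
    | dig a b _ _ ih1 ih2 =>
      exact CcaPiece.add ((CcaPiece.tree_of_isTree (Or.inr ⟨_, _, rfl⟩) b).trans (ih1.tree b)) ih2

end CcaPiece

/-! ### Kruskal's tree theorem. -/

namespace Forest

variable {A : Type*}

/-- The list of trees of a forest. -/
def trees : Forest A → List (Forest A)
  | nil => []
  | cons a c s => tree a c :: trees s

theorem isTree_of_mem_trees {s t : Forest A} (h : t ∈ s.trees) : t.IsTree := by
  induction s with
  | nil => simp [trees] at h
  | cons a c s _ ih =>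
    rcases List.mem_cons.mp h with rfl | h
    · exact ⟨a, c, rfl⟩
    · exact ih h

theorem size_le_of_mem_trees {s t : Forest A} (h : t ∈ s.trees) : t.size ≤ s.size := by
  induction s with
  | nil => simp [trees] at h
  | cons a c s _ ih =>
    rcases List.mem_cons.mp h with rfl | h
    · simp [size, tree]
    · exact (ih h).trans (by simp [size])

theorem le_of_mem_trees {s t : Forest A} (h : t ∈ s.trees) : t ≤ s := by
  induction s with
  | nil => simp [trees] at h
  | cons a c s _ ih =>
    rcases List.mem_cons.mp h with rfl | h
    · exact le_add_right (tree a c) s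
    · exact Emb.skip _ _ (ih h)

theorem le_of_sublistForall₂ {s t : Forest A}
    (h : List.SublistForall₂ (· ≤ ·) s.trees t.trees) : s ≤ t := by
  induction t generalizing s with
  | nil =>
    cases s with
    | nil => exact le_rfl
    | cons a c s => simp only [trees] at h; cases h
  | cons b d t _ ih =>
    cases s with
    | nil => exact zero_le _
    | cons a c s =>
      cases h with
      | cons h1 h2 => exact add_le_add (s := tree a c) (s' := tree b d) h1 (ih h2)
      | cons_right h => exact Emb.skip _ _ (ih (s := cons a c s) h)

open Set.PartiallyWellOrderedOn in
/-- **Kruskal's tree theorem** for trees over a finite alphabet. -/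
theorem partiallyWellOrderedOn_isTree [Finite A] :
    {s : Forest A | s.IsTree}.PartiallyWellOrderedOn (· ≤ ·) := by
  rw [iff_not_exists_isMinBadSeq size]
  rintro ⟨f, hf, hmin⟩
  choose a c hac using hf.1
  -- Nash-Williams: the child trees of a minimal bad sequence are well-quasi-ordered. Given a bad
  -- sequence `g` of them, start it at the index `i` with the earliest parent `f (k i)` and splice
  -- it after the terms of `f` before that parent; the result is bad and smaller at `k i`.
  have hpwo : {t | ∃ n, t ∈ (c n).trees}.PartiallyWellOrderedOn
      ((· ≤ ·) : Forest A → Forest A → Prop) := by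
    rw [iff_forall_not_isBadSeq]
    rintro g ⟨hg, hbad⟩
    choose k hk using hg
    obtain ⟨i, hi⟩ : ∃ i, ∀ j, k i ≤ k j := by
      obtain ⟨m, ⟨i, rfl⟩, hi⟩ := WellFounded.has_min (r := (· < ·)) wellFounded_lt
        (Set.range k) (Set.range_nonempty k)
      exact ⟨i, fun j => not_lt.mp (hi _ ⟨j, rfl⟩)⟩
    have hle : ∀ j, g j ≤ f (k j) := fun j => by
      rw [hac]
      exact IsTreeOrZero.le_tree (Or.inr (isTree_of_mem_trees (hk j))) _ (le_of_mem_trees (hk j))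
    refine hmin (k i) (fun m => if m < k i then f m else g (i + (m - k i)))
      (fun m hm => by simp [hm]) ?_ ⟨fun m => ?_, fun m n hmn => ?_⟩
    · simp only [lt_irrefl, if_false, Nat.sub_self, Nat.add_zero]
      have := size_le_of_mem_trees (hk i)
      rw [hac (k i), size_tree]
      omega
    · dsimp only
      split_ifs
      · exact hf.1 m
      · exact isTree_of_mem_trees (hk _)
    · dsimp only
      split_ifs with h1 h2 h2
      · exact hf.2 m n hmn
      · intro h
        refine hf.2 m (k (i + (n - k i))) (h1.trans_le (hi _)) (h.trans (hle _))
      · omega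
      · exact hbad _ _ (by omega)
  have hlist := Set.PartiallyWellOrderedOn.partiallyWellOrderedOn_sublistForall₂ _ hpwo
  -- A subsequence monotone for equality has constant root label, so it remains to compare the lists
  -- of children by Higman's lemma.
  obtain ⟨φ, hφ⟩ := (Finite.wellQuasiOrdered (α := A) (· = ·)).exists_monotone_subseq a
  obtain ⟨m, n, hmn, h⟩ := Set.partiallyWellOrderedOn_iff_exists_lt.mp hlist
    (fun n => (c (φ n)).trees) (fun n x hx => ⟨_, hx⟩)
  refine hf.2 _ _ (φ.strictMono hmn) ?_
  rw [hac, hac, hφ m n hmn.le]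
  exact tree_le_tree _ (le_of_sublistForall₂ h)

/-- **Kruskal's tree theorem**: forests over a finite alphabet are well-quasi-ordered. -/
instance [Finite A] : WellQuasiOrderedLE (Forest A) where
  wqo f := by
    have := Set.PartiallyWellOrderedOn.partiallyWellOrderedOn_sublistForall₂ _
      (partiallyWellOrderedOn_isTree (A := A))
    obtain ⟨m, n, hmn, h⟩ := Set.partiallyWellOrderedOn_iff_exists_lt.mp this
      (fun n => (f n).trees) (fun n x hx => isTree_of_mem_trees hx)
    exact ⟨m, n, hmn, le_of_sublistForall₂ h⟩

end Forest

namespace Forest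

variable {A : Type*}

theorem exists_tree_of_le {s w : Forest A} (hs : s.IsTree) (h : s ≤ w) :
    ∃ x b d y, w = x + tree b d + y ∧ s ≤ tree b d := by
  induction w with
  | nil => exact absurd (le_zero.mp h) hs.ne_zero
  | cons b d w _ ih =>
    rcases IsTreeOrZero.le_add_cases (Or.inr hs) (t := tree b d) (u := w) h with h | h
    · exact ⟨0, b, d, w, rfl, h⟩
    · obtain ⟨x, e, f, y, rfl, h'⟩ := ih h
      exact ⟨cons b d x, e, f, y, rfl, h'⟩

end Forest

/-! ### The embedding order on contexts, and its compatibility with substitution. -/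

namespace ForestContext

open Forest

variable {A : Type*}

theorem one_def : (1 : ForestContext A) = hole 0 0 := rfl

theorem hole_mul (l r : Forest A) (q : ForestContext A) : hole l r * q = surround l q r := rfl

theorem node_mul (l r : Forest A) (a : A) (p q : ForestContext A) :
    node l a p r * q = node l a (p * q) r := rfl

theorem hole_mul_hole (l r l' r' : Forest A) :
    hole l r * hole l' r' = hole (l + l') (r' + r) := rfl

theorem markHole_hole (l r : Forest A) :
    (hole l r).markHole = l.map some + tree none 0 + r.map some := rfl

theorem markHole_node (l r : Forest A) (a : A) (p : ForestContext A) :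
    (node l a p r).markHole = l.map some + tree (some a) p.markHole + r.map some := rfl

@[simp] theorem markHole_surround (l r : Forest A) (p : ForestContext A) :
    (surround l p r).markHole = l.map some + p.markHole + r.map some := by
  cases p <;> simp [surround, markHole_hole, markHole_node, add_assoc]

theorem markHole_ne_map_some (p : ForestContext A) (s : Forest A) : p.markHole ≠ s.map some := by
  induction p generalizing s with
  | hole l r =>
    intro h
    rw [markHole_hole] at h
    have := exists_of_le_map (h ▸ (le_add_left _ _).trans (le_add_right _ _) :
      tree none 0 ≤ s.map some)
    obtain ⟨t, ht, -⟩ := this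
    cases t with
    | nil => simp [map, tree] at ht
    | cons => simp [map, tree] at ht
  | node l a p r ih =>
    intro h
    rw [markHole_node] at h
    have := exists_of_le_map (h ▸ (le_add_left _ _).trans (le_add_right _ _) :
      tree (some a) p.markHole ≤ s.map some)
    obtain ⟨t, ht, -⟩ := this
    cases t with
    | nil => simp [map, tree] at ht
    | cons b d t =>
      simp only [map, tree, cons.injEq] at ht
      exact ih d ht.2.1

/-- The middle tree is the first one that is not entirely labelled in `A`, so its position can be
read off from the sum. -/
theorem add_tree_add_inj {l l' : Forest A} {r r' c c' : Forest (Option A)} {x x' : Option A}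
    (hc : ∀ s, tree x c ≠ map some s) (hc' : ∀ s, tree x' c' ≠ map some s)
    (h : l.map some + tree x c + r = l'.map some + tree x' c' + r') :
    l = l' ∧ x = x' ∧ c = c' ∧ r = r' := by
  induction l generalizing l' with
  | nil =>
    cases l' with
    | nil =>
      obtain ⟨h1, h2, h3⟩ := (cons.injEq ..).mp (show cons x c r = cons x' c' r' from h)
      exact ⟨rfl, h1, h2, h3⟩
    | cons b d l' =>
      obtain ⟨h1, h2, h3⟩ := (cons.injEq ..).mp
        (show cons x c r = cons (some b) (d.map some) (l'.map some + tree x' c' + r') from h)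
      exact absurd (by rw [h1, h2]; rfl) (hc (tree b d))
  | cons b d l _ ih =>
    cases l' with
    | nil =>
      obtain ⟨h1, h2, h3⟩ := (cons.injEq ..).mp
        (show cons (some b) (d.map some) (l.map some + tree x c + r) = cons x' c' r' from h)
      exact absurd (by rw [← h1, ← h2]; rfl) (hc' (tree b d))
    | cons b' d' l' =>
      obtain ⟨h1, h2, h3⟩ := (cons.injEq ..).mp
        (show cons (some b) (d.map some) (l.map some + tree x c + r) =
          cons (some b') (d'.map some) (l'.map some + tree x' c' + r') from h)
      obtain ⟨rfl, rest⟩ := ih h3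
      obtain rfl := Option.some.inj h1
      obtain rfl := map_injective (Option.some_injective _) h2
      exact ⟨rfl, rest⟩

theorem tree_none_ne_map_some (c : Forest (Option A)) (s : Forest A) :
    tree none c ≠ map some s := by
  cases s <;> simp [tree, map]

theorem tree_markHole_ne_map_some (a : Option A) (p : ForestContext A) (s : Forest A) :
    tree a p.markHole ≠ map some s := by
  cases s with
  | nil => simp [tree, map]
  | cons b d s =>
    intro h
    simp only [map, tree, cons.injEq] at h
    exact markHole_ne_map_some p d h.2.1

theorem markHole_injective : (markHole : ForestContext A → _).Injective := by
  intro p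
  induction p with
  | hole l r =>
    intro q h
    cases q with
    | hole l' r' =>
      obtain ⟨rfl, -, -, h⟩ := add_tree_add_inj (tree_none_ne_map_some _)
        (tree_none_ne_map_some _) h
      rw [map_injective (Option.some_injective _) h]
    | node l' a q r' =>
      have := add_tree_add_inj (tree_none_ne_map_some _) (tree_markHole_ne_map_some _ _) h
      exact absurd this.2.1 nofun
  | node l a p r ih =>
    intro q h
    cases q with
    | hole l' r' =>
      have := add_tree_add_inj (tree_markHole_ne_map_some _ _) (tree_none_ne_map_some _) h
      exact absurd this.2.1 nofun
    | node l' a' q r' =>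
      obtain ⟨rfl, h1, h2, h3⟩ := add_tree_add_inj (tree_markHole_ne_map_some _ _)
        (tree_markHole_ne_map_some _ _) h
      rw [map_injective (Option.some_injective _) h3, ih h2, Option.some.inj h1]

/-- Homeomorphic embedding of contexts, defined structurally. -/
inductive Emb : ForestContext A → ForestContext A → Prop
  | hole_hole {l l' r r' : Forest A} : l ≤ l' → r ≤ r' → Emb (hole l r) (hole l' r')
  | hole_node (b : A) (q : ForestContext A) {l l' r r' : Forest A} :
      l ≤ l' → r ≤ r' → Emb (hole l r) (node l' b q r')
  | node_node (a : A) {l l' r r' : Forest A} {p q : ForestContext A} :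
      l ≤ l' → Emb p q → r ≤ r' → Emb (node l a p r) (node l' a q r')
  | dig (a b : A) {l l' r r' : Forest A} {p q : ForestContext A} :
      l ≤ l' → Emb (node 0 a p 0) q → r ≤ r' → Emb (node l a p r) (node l' b q r')

/-- Contexts are preordered by embedding, where the hole is a leaf with a label of its own. -/
instance : Preorder (ForestContext A) := Preorder.lift markHole

theorem le_iff_markHole_le {p q : ForestContext A} : p ≤ q ↔ p.markHole ≤ q.markHole := Iff.rfl

instance [Finite A] : WellQuasiOrderedLE (ForestContext A) where
  wqo f := wellQuasiOrdered_le fun n => (f n).markHole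

theorem tree_none_le_markHole (q : ForestContext A) : tree none 0 ≤ q.markHole := by
  induction q with
  | hole l r => exact (le_add_left _ _).trans (le_add_right _ _)
  | node l a q r ih =>
    exact (IsTreeOrZero.le_tree (Or.inr (isTree_tree _ _)) _ ih).trans
      ((le_add_left _ _).trans (le_add_right _ _))

theorem Emb.le {p q : ForestContext A} (h : Emb p q) : p ≤ q := by
  rw [le_iff_markHole_le]
  induction h with
  | hole_hole hl hr =>
    exact add_le_add (add_le_add (map_le_map _ hl) le_rfl) (map_le_map _ hr)
  | hole_node b q hl hr =>
    exact add_le_add (add_le_add (map_le_map _ hl)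
      (IsTreeOrZero.le_tree (Or.inr (isTree_tree _ _)) _ (tree_none_le_markHole q)))
      (map_le_map _ hr)
  | node_node a hl _ hr ih =>
    exact add_le_add (add_le_add (map_le_map _ hl) (tree_le_tree _ ih)) (map_le_map _ hr)
  | dig a b hl _ hr ih =>
    exact add_le_add (add_le_add (map_le_map _ hl)
      (IsTreeOrZero.le_tree (Or.inr (isTree_tree _ _)) _ (by simpa [markHole_node] using ih)))
      (map_le_map _ hr)

/-- The marked leaf is either lost or survives as a leaf. If it survives below a deleted root, the
piece there is a single tree, so it has no siblings at top level and `Emb.dig` or `Emb.hole_node`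
applies. -/
theorem exists_of_le_markHole {q : ForestContext A} {w : Forest (Option A)}
    (h : w ≤ q.markHole) :
    (∃ s, w = map some s) ∨ ∃ p, w = p.markHole ∧ Emb p q := by
  induction q generalizing w with
  | hole l r =>
    obtain ⟨w', w3, rfl, h', h3⟩ := exists_of_le_add h
    obtain ⟨w1, w2, rfl, h1, h2⟩ := exists_of_le_add h'
    obtain ⟨l', rfl, hl⟩ := exists_of_le_map h1
    obtain ⟨r', rfl, hr⟩ := exists_of_le_map h3
    rcases le_tree_cases h2 with rfl | ⟨d, rfl, hd⟩ | ⟨h, hd⟩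
    · exact Or.inl ⟨l' + r', by simp⟩
    · obtain rfl := le_zero.mp hd
      exact Or.inr ⟨hole l' r', rfl, .hole_hole hl hr⟩
    · exact absurd (le_zero.mp hd) h.ne_zero
  | node l b q r ih =>
    obtain ⟨w', w3, rfl, h', h3⟩ := exists_of_le_add h
    obtain ⟨w1, w2, rfl, h1, h2⟩ := exists_of_le_add h'
    obtain ⟨l', rfl, hl⟩ := exists_of_le_map h1
    obtain ⟨r', rfl, hr⟩ := exists_of_le_map h3
    rcases le_tree_cases h2 with rfl | ⟨d, rfl, hd⟩ | ⟨ht, hd⟩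
    · exact Or.inl ⟨l' + r', by simp⟩
    · rcases ih hd with ⟨s, rfl⟩ | ⟨p, rfl, hp⟩
      · exact Or.inl ⟨l' + tree b s + r', by simp⟩
      · exact Or.inr ⟨node l' b p r', rfl, .node_node b hl hp hr⟩
    · rcases ih hd with ⟨s, rfl⟩ | ⟨p, rfl, hp⟩
      · exact Or.inl ⟨l' + s + r', by simp⟩
      · refine Or.inr ⟨surround l' p r', by simp, ?_⟩
        obtain ⟨x, c, hx⟩ := ht
        cases p with
        | hole l2 r2 =>
          obtain ⟨e1, -, -, e2⟩ := add_tree_add_inj (l' := 0) (r' := 0)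
            (tree_none_ne_map_some _) (by rw [← hx]; exact markHole_ne_map_some _)
            (by simpa [markHole_hole] using hx)
          obtain rfl := e1
          obtain rfl := map_injective (Option.some_injective _) (e2.trans (Forest.map_zero _).symm)
          simpa [surround] using Emb.hole_node b q hl hr
        | node l2 a p r2 =>
          obtain ⟨e1, -, -, e2⟩ := add_tree_add_inj (l' := 0) (r' := 0)
            (tree_markHole_ne_map_some _ _) (by rw [← hx]; exact markHole_ne_map_some _)
            (by simpa [markHole_node] using hx)
          obtain rfl := e1
          obtain rfl := map_injective (Option.some_injective _) (e2.trans (Forest.map_zero _).symm)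
          simpa [surround] using Emb.dig a b hl hp hr

theorem Emb.of_le {p q : ForestContext A} (h : p ≤ q) : Emb p q := by
  rcases exists_of_le_markHole (le_iff_markHole_le.mp h) with ⟨s, hs⟩ | ⟨p', hp, h⟩
  · exact absurd hs (markHole_ne_map_some p s)
  · exact markHole_injective hp ▸ h

theorem contextCcaPiece_iff_le {p q : ForestContext A} : ContextCcaPiece p q ↔ p ≤ q :=
  ccaPiece_iff_le

theorem hole_le_hole {l l' r r' : Forest A} :
    (hole l r ≤ hole l' r') ↔ l ≤ l' ∧ r ≤ r' := by
  refine ⟨fun h => ?_, fun h => (Emb.hole_hole h.1 h.2).le⟩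
  cases Emb.of_le h with
  | hole_hole hl hr => exact ⟨hl, hr⟩

theorem one_le (p : ForestContext A) : 1 ≤ p := by
  cases p with
  | hole l r => exact (Emb.hole_hole (zero_le _) (zero_le _)).le
  | node l a p r => exact (Emb.hole_node _ _ (zero_le _) (zero_le _)).le

/-- The context is a tree-context or empty. -/
def IsTreeOrOne (p : ForestContext A) : Prop := p = 1 ∨ p.IsTreeContext

theorem isTreeOrOne_node (a : A) (p : ForestContext A) : (node 0 a p 0).IsTreeOrOne :=
  Or.inr ⟨a, p, rfl⟩

theorem IsTreeOrOne.of_le {p q : ForestContext A} (hq : q.IsTreeOrOne) (h : p ≤ q) :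
    p.IsTreeOrOne := by
  rcases hq with rfl | ⟨a, q, rfl⟩
  · cases Emb.of_le h with
    | hole_hole hl hr =>
      rw [Forest.le_zero.mp hl, Forest.le_zero.mp hr]
      exact Or.inl rfl
  · cases Emb.of_le h with
    | hole_node _ _ hl hr =>
      rw [Forest.le_zero.mp hl, Forest.le_zero.mp hr]
      exact Or.inl rfl
    | node_node _ hl _ hr =>
      rw [Forest.le_zero.mp hl, Forest.le_zero.mp hr]
      exact isTreeOrOne_node _ _
    | dig _ _ hl _ hr =>
      rw [Forest.le_zero.mp hl, Forest.le_zero.mp hr]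
      exact isTreeOrOne_node _ _

theorem IsTreeOrOne.mul {p q : ForestContext A} (hp : p.IsTreeOrOne) (hq : q.IsTreeOrOne) :
    (p * q).IsTreeOrOne := by
  rcases hp with rfl | ⟨a, p, rfl⟩
  · rwa [one_mul]
  · exact isTreeOrOne_node _ _

theorem isTree_node_smul (a : A) (p : ForestContext A) (s : Forest A) :
    (node 0 a p 0 • s).IsTree := ⟨a, p • s, by simp [node_smul]⟩

theorem IsTreeOrOne.smul {p : ForestContext A} {s : Forest A} (hp : p.IsTreeOrOne)
    (hs : s.IsTreeOrZero) : (p • s).IsTreeOrZero := by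
  rcases hp with rfl | ⟨a, p, rfl⟩
  · rwa [one_smul]
  · exact Or.inr (isTree_node_smul ..)

theorem size_smul (p : ForestContext A) (s : Forest A) :
    (p • s).size = (p • (0 : Forest A)).size + s.size := by
  induction p with
  | hole l r => simp [hole_smul]; ring
  | node l a p r ih => simp [node_smul, ih]; ring

theorem eq_one_of_smul_zero {p : ForestContext A} (h : p • (0 : Forest A) = 0) : p = 1 := by
  cases p with
  | hole l r =>
    rw [hole_smul, add_zero] at h
    obtain ⟨rfl, rfl⟩ := add_eq_zero.mp h
    rfl
  | node l a p r => simp [node_smul, add_eq_zero, tree_ne_zero] at h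

theorem eq_one_of_size {p : ForestContext A} {s : Forest A} (h : (p • s).size ≤ s.size) :
    p = 1 := by
  rw [size_smul] at h
  exact eq_one_of_smul_zero (size_eq_zero.mp (by omega))

theorem isTreeOrOne_of_smul {p : ForestContext A} {s : Forest A} (hs : s ≠ 0)
    (h : (p • s).IsTreeOrZero) : p.IsTreeOrOne := by
  cases p with
  | hole l r =>
    rw [hole_smul] at h
    rcases h with h | ⟨a, c, h⟩
    · exact absurd (add_eq_zero.mp (add_eq_zero.mp h).1).2 hs
    · rcases add_eq_tree h with ⟨h', -⟩ | ⟨h', rfl⟩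
      · exact absurd (add_eq_zero.mp h').2 hs
      · rcases add_eq_tree h' with ⟨rfl, -⟩ | ⟨-, h⟩
        · exact Or.inl rfl
        · exact absurd h hs
  | node l a p r =>
    rw [node_smul] at h
    rcases h with h | ⟨b, c, h⟩
    · exact absurd (add_eq_zero.mp (add_eq_zero.mp h).1).2 (tree_ne_zero _ _)
    · rcases add_eq_tree h with ⟨h', -⟩ | ⟨h', rfl⟩
      · exact absurd (add_eq_zero.mp h').2 (tree_ne_zero _ _)
      · rcases add_eq_tree h' with ⟨rfl, -⟩ | ⟨-, h⟩
        · exact isTreeOrOne_node _ _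
        · exact absurd h (tree_ne_zero _ _)

theorem le_smul {s : Forest A} (hs : s.IsTreeOrZero) (p : ForestContext A) : s ≤ p • s := by
  induction p with
  | hole l r => exact (le_add_left _ _).trans (le_add_right _ _)
  | node l a p r ih =>
    exact (hs.le_tree a ih).trans ((le_add_left _ _).trans (le_add_right _ _))

/-- In `q` the hole may lie below additional nodes, and `s` can be placed below those only if it is
a tree or empty. -/
theorem smul_le_smul_left {p q : ForestContext A} (h : p ≤ q) {s : Forest A}
    (hs : s.IsTreeOrZero) : p • s ≤ q • s := by
  induction Emb.of_le h with
  | hole_hole hl hr => exact add_le_add (add_le_add hl le_rfl) hr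
  | hole_node b q hl hr =>
    exact add_le_add (add_le_add hl (hs.le_tree b (le_smul hs q))) hr
  | node_node a hl h' hr ih =>
    exact add_le_add (add_le_add hl (tree_le_tree a (ih h'.le))) hr
  | dig a b hl h' hr ih =>
    have := ih h'.le
    rw [node_smul, zero_add, add_zero] at this
    exact add_le_add (add_le_add hl (IsTreeOrZero.le_tree (Or.inr (isTree_tree _ _)) b this)) hr

theorem mul_le_mul_right' (p : ForestContext A) {q q' : ForestContext A} (h : q ≤ q') :
    p * q ≤ p * q' := by
  induction p with
  | hole l r =>
    rw [hole_mul, hole_mul, le_iff_markHole_le, markHole_surround, markHole_surround]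
    exact add_le_add (add_le_add le_rfl h) le_rfl
  | node l a p r ih => exact add_le_add (add_le_add le_rfl (tree_le_tree _ ih)) le_rfl

theorem IsTreeOrOne.isTree_markHole {p : ForestContext A} (hp : p.IsTreeOrOne) :
    p.markHole.IsTree := by
  rcases hp with rfl | ⟨a, p, rfl⟩
  · exact ⟨none, 0, rfl⟩
  · exact ⟨some a, p.markHole, by simp [markHole_node]⟩

theorem le_mul_left {q : ForestContext A} (hq : q.IsTreeOrOne) (p : ForestContext A) :
    q ≤ p * q := by
  rw [le_iff_markHole_le]
  induction p with
  | hole l r =>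
    rw [hole_mul, markHole_surround]
    exact (le_add_left _ _).trans (le_add_right _ _)
  | node l a p r ih =>
    exact (IsTreeOrZero.le_tree (Or.inr hq.isTree_markHole) _ ih).trans
      ((le_add_left _ _).trans (le_add_right _ _))

theorem le_mul_right (p q : ForestContext A) : p ≤ p * q := by
  simpa using mul_le_mul_right' p (one_le q)

theorem mul_le_mul_left' {p p' : ForestContext A} (h : p ≤ p') {q : ForestContext A}
    (hq : q.IsTreeOrOne) : p * q ≤ p' * q := by
  induction Emb.of_le h with
  | hole_hole hl hr =>
    rw [hole_mul, hole_mul, le_iff_markHole_le, markHole_surround, markHole_surround]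
    exact add_le_add (add_le_add (map_le_map _ hl) le_rfl) (map_le_map _ hr)
  | hole_node b p hl hr =>
    rw [hole_mul, le_iff_markHole_le, markHole_surround]
    exact add_le_add (add_le_add (map_le_map _ hl)
      (IsTreeOrZero.le_tree (Or.inr hq.isTree_markHole) _ (le_mul_left hq p))) (map_le_map _ hr)
  | node_node a hl h' hr ih => exact (Emb.node_node a hl (Emb.of_le (ih h'.le)) hr).le
  | dig a b hl h' hr ih => exact (Emb.dig a b hl (Emb.of_le (ih h'.le)) hr).le

/-- Factorisations propagate upwards. The induction is on the size of `w`, since in the `dig` case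
the context does not shrink while `w` does. -/
theorem exists_of_smul_le {p : ForestContext A} {s w : Forest A} (hs : s.IsTree)
    (h : p • s ≤ w) : ∃ p' s', w = p' • s' ∧ p ≤ p' ∧ s ≤ s' ∧ s'.IsTree := by
  induction hn : w.size using Nat.strong_induction_on generalizing p w with
  | _ n ih =>
    cases p with
    | hole l r =>
      obtain ⟨w', w3, rfl, h', h3⟩ := exists_of_add_le h
      obtain ⟨w1, w2, rfl, h1, h2⟩ := exists_of_add_le h'
      obtain ⟨x, b, d, y, rfl, hx⟩ := exists_tree_of_le hs h2
      refine ⟨hole (w1 + x) (y + w3), tree b d, by simp [hole_smul, add_assoc], ?_, hx,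
        isTree_tree _ _⟩
      exact hole_le_hole.mpr ⟨h1.trans (le_add_right _ _), h3.trans (le_add_left _ _)⟩
    | node l a p r =>
      obtain ⟨w', w3, rfl, h', h3⟩ := exists_of_add_le h
      obtain ⟨w1, w2, rfl, h1, h2⟩ := exists_of_add_le h'
      obtain ⟨x, b, d, y, rfl, hx⟩ := exists_tree_of_le (isTree_tree _ _) h2
      have hd : d.size < n := by simp at hn; omega
      have hl := h1.trans (le_add_right _ x)
      have hr := h3.trans (le_add_left y _)
      rcases le_tree_cases hx with hx | ⟨e, he, hx⟩ | ⟨-, hx⟩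
      · exact absurd hx (tree_ne_zero _ _)
      · obtain ⟨rfl, rfl, -⟩ := (cons.injEq ..).mp he
        obtain ⟨p', s', rfl, hp, hs', ht⟩ := ih _ hd hx rfl
        exact ⟨node (w1 + x) a p' (y + w3), s', by simp [node_smul, add_assoc],
          (Emb.node_node a hl (Emb.of_le hp) hr).le, hs', ht⟩
      · obtain ⟨p', s', rfl, hp, hs', ht⟩ := ih _ hd (p := node 0 a p 0)
          (by simpa [node_smul] using (show tree a (p • s) ≤ d from hx)) rfl
        exact ⟨node (w1 + x) b p' (y + w3), s', by simp [node_smul, add_assoc],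
          (Emb.dig a b hl (Emb.of_le hp) hr).le, hs', ht⟩

/-- Factorisations propagate downwards, unless nothing of `s` is needed. The first alternative is
what the clause `before` of `IsRegion` records. -/
theorem exists_of_le_smul {p : ForestContext A} {s w : Forest A} (hs : s.IsTreeOrZero)
    (h : w ≤ p • s) :
    w ≤ p • (0 : Forest A) ∨ ∃ p' s', w = p' • s' ∧ p' ≤ p ∧ s' ≤ s ∧ s'.IsTree := by
  induction p generalizing w with
  | hole l r =>
    obtain ⟨w', w3, rfl, h', h3⟩ := exists_of_le_add h
    obtain ⟨w1, w2, rfl, h1, h2⟩ := exists_of_le_add h'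
    rcases hs.of_le h2 with rfl | ht
    · exact Or.inl (add_le_add (add_le_add h1 le_rfl) h3)
    · exact Or.inr ⟨hole w1 w3, w2, rfl, hole_le_hole.mpr ⟨h1, h3⟩, h2, ht⟩
  | node l a p r ih =>
    obtain ⟨w', w3, rfl, h', h3⟩ := exists_of_le_add h
    obtain ⟨w1, w2, rfl, h1, h2⟩ := exists_of_le_add h'
    rcases le_tree_cases h2 with rfl | ⟨d, rfl, hd⟩ | ⟨ht, hd⟩
    · exact Or.inl (add_le_add (add_le_add h1 (zero_le _)) h3)
    · rcases ih hd with hd | ⟨p', s', rfl, hp, hs', ht⟩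
      · exact Or.inl (add_le_add (add_le_add h1 (tree_le_tree a hd)) h3)
      · exact Or.inr ⟨node w1 a p' w3, s', rfl, (Emb.node_node a h1 (Emb.of_le hp) h3).le,
          hs', ht⟩
    · rcases ih hd with hd | ⟨p', s', rfl, hp, hs', hst⟩
      · exact Or.inl (add_le_add (add_le_add h1 (IsTreeOrZero.le_tree (Or.inr ht) a hd)) h3)
      · refine Or.inr ⟨surround w1 p' w3, s', ?_, ?_, hs', hst⟩
        · exact (surround_fill w1 w3 s' p').symm
        · rcases isTreeOrOne_of_smul hst.ne_zero (Or.inr ht) with rfl | ⟨b, p', rfl⟩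
          · simpa [one_def, surround] using (Emb.hole_node a p h1 h3).le
          · simpa [surround] using (Emb.dig b a h1 (Emb.of_le hp) h3).le

/-- The cut in `w` is made above the node at which the embedding of the tree-context `p` begins. A
power below `w` thus splits `w` into that many large factors. -/
theorem exists_of_mul_le {u p w : ForestContext A} (hp : p.IsTreeOrOne) (h : u * p ≤ w) :
    ∃ w1 w2, w = w1 * w2 ∧ u ≤ w1 ∧ p ≤ w2 ∧ w2.IsTreeOrOne := by
  rcases hp with rfl | ⟨a, p, rfl⟩
  · exact ⟨w, 1, (mul_one w).symm, by simpa using h, le_rfl, Or.inl rfl⟩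
  induction w generalizing u with
  | hole l r =>
    cases u with
    | hole l' r' => cases Emb.of_le h
    | node l' b u r' => cases Emb.of_le h
  | node l c w r ih =>
    cases u with
    | hole l' r' =>
      have h' : l' ≤ l ∧ node 0 a p 0 ≤ node 0 c w 0 ∧ r' ≤ r := by
        have h := Emb.of_le h
        simp only [hole_mul, surround, zero_add, add_zero] at h
        cases h with
        | node_node _ hl h hr => exact ⟨hl, (Emb.node_node _ le_rfl h le_rfl).le, hr⟩
        | dig _ _ hl h hr => exact ⟨hl, (Emb.dig _ _ le_rfl h le_rfl).le, hr⟩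
      exact ⟨hole l r, node 0 c w 0, by simp [hole_mul, surround],
        hole_le_hole.mpr ⟨h'.1, h'.2.2⟩, h'.2.1, isTreeOrOne_node _ _⟩
    | node l' b u r' =>
      have h := Emb.of_le h
      rw [node_mul] at h
      cases h with
      | node_node _ hl h hr =>
        obtain ⟨w1, w2, rfl, h1, h2, h3⟩ := ih h.le
        exact ⟨node l _ w1 r, w2, rfl, (Emb.node_node _ hl (Emb.of_le h1) hr).le, h2, h3⟩
      | dig _ _ hl h hr =>
        obtain ⟨w1, w2, rfl, h1, h2, h3⟩ := ih (u := node 0 b u 0) h.le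
        exact ⟨node l c w1 r, w2, rfl, (Emb.dig b c hl (Emb.of_le h1) hr).le, h2, h3⟩

end ForestContext

/-! ### Absorbing contexts in lower submonoids. -/

section

open Filter

section Types

variable {A : Type*} (L : Set (Forest A))

theorem forestType_smul_congr {s t : Forest A} (p : ForestContext A)
    (h : forestType L s = forestType L t) : forestType L (p • s) = forestType L (p • t) := by
  rw [← contextType_smul_forestType, h, contextType_smul_forestType]

theorem forestType_smul_of_contextType {p q : ForestContext A}
    (h : contextType L p = contextType L q) (s : Forest A) :
    forestType L (p • s) = forestType L (q • s) := by
  rw [← contextType_smul_forestType, h, contextType_smul_forestType]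

theorem contextType_mul (p q : ForestContext A) :
    contextType L (p * q) = contextType L p * contextType L q := rfl

theorem contextType_pow (p : ForestContext A) (n : ℕ) :
    contextType L (p ^ n) = contextType L p ^ n := by
  induction n with
  | zero => rfl
  | succ n ih => rw [pow_succ, pow_succ, contextType_mul, ih]

theorem forestType_add (s t : Forest A) :
    forestType L (s + t) = forestType L s + forestType L t := rfl

theorem forestType_nsmul (n : ℕ) (s : Forest A) :
    forestType L (n • s) = n • forestType L s := by
  induction n with
  | zero => simp only [zero_nsmul]; rfl
  | succ n ih => rw [succ_nsmul, succ_nsmul, forestType_add, ih]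

/-- The types along the sequence are eventually constant. -/
def EventuallyConstType (x : ℕ → Forest A) : Prop :=
  ∃ h, ∀ᶠ n in atTop, forestType L (x n) = h

end Types

/-- The closure properties shared by the pair (contexts with the hole at top level, forests) and
the pair (tree-contexts and the empty context, trees and the empty forest). -/
structure IsAbsorbing {A : Type*} (L : Set (Forest A)) (ω : ℕ) (K : Set (ForestContext A))
    (S : Set (Forest A)) : Prop where
  one_mem : 1 ∈ K
  mul_mem {p q} : p ∈ K → q ∈ K → p * q ∈ K
  lower {p q} : p ≤ q → q ∈ K → p ∈ K
  zero_mem : 0 ∈ S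
  smul_mem {p s} : p ∈ K → s ∈ S → p • s ∈ S
  mul_mono {p p' q q'} : p ≤ p' → q ≤ q' → p' ∈ K → q' ∈ K → p * q ≤ p' * q'
  smul_mono {p q s} : p ≤ q → q ∈ K → s ∈ S → p • s ≤ q • s
  factor {u p w} : p ∈ K → w ∈ K → u * p ≤ w →
    ∃ w1 w2, w = w1 * w2 ∧ u ≤ w1 ∧ p ≤ w2 ∧ w2 ∈ K
  absorb {p q s} : p ≤ q → q ∈ K → s ∈ S →
    forestType L (q ^ ω • p • s) = forestType L (q ^ ω • s) ∧
    forestType L (p • q ^ ω • s) = forestType L (q ^ ω • s)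
  -- Needed where the subforest is empty and the forest survives only inside a context: what embeds
  -- in a context of `E` with empty hole is invisible below `e`.
  remainder {E : Set (ForestContext A)} {e q : ForestContext A} {s : Forest A} :
    (∀ p q, p ≤ q → q ∈ E → p ∈ E) →
    (∀ p ∈ E, ∀ s ∈ S, forestType L (e • p • s) = forestType L (e • s)) →
    q ∈ E → q ∈ K → s ∈ S → s ≤ q • (0 : Forest A) →
    forestType L (e • s) = forestType L (e • (0 : Forest A))

/-- A lower submonoid of contexts in `K`. -/
structure IsLowerSubmonoid {A : Type*} (K E : Set (ForestContext A)) : Prop where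
  subset : E ⊆ K
  one_mem : 1 ∈ E
  mul_mem {p q} : p ∈ E → q ∈ E → p * q ∈ E
  lower {p q} : p ≤ q → q ∈ E → p ∈ E

namespace IsLowerSubmonoid

variable {A : Type*} {L : Set (Forest A)} {ω : ℕ} {K E : Set (ForestContext A)}
  {S : Set (Forest A)}

theorem pow_mem (hE : IsLowerSubmonoid K E) {p : ForestContext A} (hp : p ∈ E) (n : ℕ) :
    p ^ n ∈ E := by
  induction n with
  | zero => simpa using hE.one_mem
  | succ n ih => rw [pow_succ]; exact hE.mul_mem ih hp

theorem list_prod_mem (hE : IsLowerSubmonoid K E) {l : List (ForestContext A)}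
    (hl : ∀ p ∈ l, p ∈ E) : l.prod ∈ E := by
  induction l with
  | nil => exact hE.one_mem
  | cons p l ih =>
    rw [List.prod_cons]
    exact hE.mul_mem (hl p (by simp)) (ih fun q hq => hl q (by simp [hq]))

theorem exists_list_prod (hK : IsAbsorbing L ω K S) (hE : IsLowerSubmonoid K E)
    {u : ForestContext A} (hu : u ∈ E) (n : ℕ) {p : ForestContext A} (hp : p ∈ E)
    (h : u ^ (n + 1) ≤ p) :
    ∃ l : List (ForestContext A), l.length = n + 1 ∧ (∀ q ∈ l, q ∈ E ∧ u ≤ q) ∧ p = l.prod := by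
  induction n generalizing p with
  | zero => exact ⟨[p], rfl, by simpa using ⟨hp, by simpa using h⟩, by simp⟩
  | succ n ih =>
    rw [pow_succ'] at h
    obtain ⟨w1, w2, rfl, h1, h2, h3⟩ := hK.factor (hE.subset (hE.pow_mem hu _)) (hE.subset hp) h
    have hw1 : w1 ∈ E := hE.lower (ForestContext.le_mul_right w1 w2) hp
    have hw2 : w2 ∈ E := by
      refine hE.lower ?_ hp
      simpa using hK.mul_mono (ForestContext.one_le w1) (le_refl w2) (hE.subset hw1) h3
    obtain ⟨l, hl, hl', rfl⟩ := ih hw2 h2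
    refine ⟨w1 :: l, by simp [hl], ?_, by simp⟩
    intro q hq
    rcases List.mem_cons.mp hq with rfl | hq
    · exact ⟨hw1, h1⟩
    · exact hl' q hq

/-- Absorption: for some `e` and some `q` in `E`, all contexts of `E` above `q` have the same
type as `e`, and `e` absorbs the contexts of `E` on the right. -/
theorem exists_absorbing (hK : IsAbsorbing L ω K S) [Finite (SynH L)] [Finite (SynV L)]
    (hE : IsLowerSubmonoid K E) :
    ∃ e q, e ∈ E ∧ q ∈ E ∧
      (∀ p ∈ E, q ≤ p → ∀ s ∈ S, forestType L (p • s) = forestType L (e • s)) ∧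
      (∀ p ∈ E, ∀ s ∈ S, forestType L (e • p • s) = forestType L (e • s)) := by
  -- A product of representatives of the finitely many types of `E`. Every context of `E` then has
  -- the type of some context below `u`, so `q ^ ω` absorbs all of `E` as soon as `u ≤ q`.
  obtain ⟨u, hu, hrep⟩ : ∃ u ∈ E, ∀ v ∈ contextType L '' E, ∃ p, contextType L p = v ∧ p ≤ u := by
    refine Set.Finite.induction_on_subset (motive := fun T _ => ∃ u ∈ E, ∀ v ∈ T, ∃ p,
      contextType L p = v ∧ p ≤ u) _ (Set.toFinite (contextType L '' E))
      ⟨1, hE.one_mem, by simp⟩ ?_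
    rintro v T ⟨p, hp, rfl⟩ - - ⟨u, hu, hT⟩
    refine ⟨u * p, hE.mul_mem hu hp, ?_⟩
    have hpu : p ≤ u * p := by
      simpa using hK.mul_mono (ForestContext.one_le u) (le_refl p) (hE.subset hu) (hE.subset hp)
    intro v hv
    rcases hv with rfl | hv
    · exact ⟨p, rfl, hpu⟩
    · obtain ⟨p', h1, h2⟩ := hT v hv
      exact ⟨p', h1, h2.trans (ForestContext.le_mul_right u p)⟩
  have habs : ∀ q ∈ E, u ≤ q → ∀ p ∈ E, ∀ s ∈ S,
      forestType L (q ^ ω • p • s) = forestType L (q ^ ω • s) ∧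
      forestType L (p • q ^ ω • s) = forestType L (q ^ ω • s) := by
    intro q hq huq p hp s hs
    obtain ⟨p', h1, h2⟩ := hrep _ ⟨p, hp, rfl⟩
    have := hK.absorb (h2.trans huq) (hE.subset hq) hs
    rw [← forestType_smul_of_contextType L h1,
      ← forestType_smul_congr L _ (forestType_smul_of_contextType L h1 s)]
    exact this
  have he : u ^ ω ∈ E := hE.pow_mem hu ω
  -- A context above this power splits into `Nat.card (SynH L) + 1` factors, each above `u`. Two
  -- proper or improper suffixes then give the same type when applied to `s`.
  refine ⟨u ^ ω, u ^ (Nat.card (SynH L) + 1), he, hE.pow_mem hu _, ?_,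
    fun p hp s hs => (habs u hu le_rfl p hp s hs).1⟩
  intro p hp hup s hs
  obtain ⟨l, hlen, hl, rfl⟩ := exists_list_prod hK hE hu _ hp hup
  have hlE : ∀ q ∈ l, q ∈ E := fun q hq => (hl q hq).1
  obtain ⟨i, j, hij, hh⟩ : ∃ i j : Fin (Nat.card (SynH L) + 1), i < j ∧
      forestType L ((l.drop i).prod • s) = forestType L ((l.drop j).prod • s) := by
    have := Fintype.ofFinite (SynH L)
    obtain ⟨i, j, hne, hh⟩ := Fintype.exists_ne_map_eq_of_card_lt
      (fun i : Fin (Nat.card (SynH L) + 1) => forestType L ((l.drop i).prod • s))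
      (by simp [Nat.card_eq_fintype_card])
    rcases lt_or_gt_of_ne hne with h | h
    · exact ⟨i, j, h, hh⟩
    · exact ⟨j, i, h, hh.symm⟩
  set t := (l.drop i).prod • s with ht
  have hdrop : (l.drop i).prod ∈ E := hE.list_prod_mem fun q hq => hlE q (List.mem_of_mem_drop hq)
  have htS : t ∈ S := hK.smul_mem (hE.subset hdrop) hs
  -- The nonempty block between the two suffixes fixes the type of `t`, hence so does `Q ^ ω`. As `u
  -- ≤ Q`, this power absorbs `E` on the left, so all of `E` fixes the type of `t`.
  set Q := ((l.drop i).take (j - i)).prod with hQ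
  have hQE : Q ∈ E := hE.list_prod_mem fun q hq =>
    hlE q (List.mem_of_mem_drop (List.mem_of_mem_take hq))
  have hQt : forestType L (Q • t) = forestType L t := by
    rw [forestType_smul_congr L Q hh, ht, ← mul_smul, hQ,
      ← List.prod_take_mul_prod_drop (l.drop i) (j - i), List.drop_drop,
      Nat.add_sub_cancel' (le_of_lt hij)]
  have huQ : u ≤ Q := by
    obtain ⟨x, l', hx⟩ : ∃ x l', (l.drop i).take (j - i) = x :: l' := by
      refine List.exists_cons_of_length_pos ?_
      have := j.2
      have : (i : ℕ) < j := hij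
      simp only [List.length_take, List.length_drop]
      omega
    have hxl : x ∈ l := by
      refine List.mem_of_mem_drop (i := i) (List.mem_of_mem_take (i := j - i) ?_)
      rw [hx]
      simp
    rw [hQ, hx, List.prod_cons]
    exact (hl x hxl).2.trans (ForestContext.le_mul_right _ _)
  have hQpow : ∀ n : ℕ, forestType L (Q ^ n • t) = forestType L t := by
    intro n
    induction n with
    | zero => simp
    | succ n ih => rw [pow_succ, mul_smul, forestType_smul_congr L _ hQt, ih]
  have hstab : ∀ p ∈ E, forestType L (p • t) = forestType L t := fun p hp => by
    rw [← forestType_smul_congr L p (hQpow ω), (habs Q hQE huQ p hp t htS).2, hQpow]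
  calc forestType L (l.prod • s)
      = forestType L ((l.take i).prod • t) := by
        rw [ht, ← mul_smul, List.prod_take_mul_prod_drop]
    _ = forestType L t :=
        hstab _ (hE.list_prod_mem fun q hq => hlE q (List.mem_of_mem_take hq))
    _ = forestType L (u ^ ω • t) := (hstab _ he).symm
    _ = forestType L (u ^ ω • s) := (habs u hu le_rfl _ hdrop s hs).1

end IsLowerSubmonoid

/-- Otherwise elements `p k` of `E k` missing from the later set `E (f k)` exist for all `k`; along
the iterates of `f` they form a bad sequence. -/
theorem WellQuasiOrderedLE.exists_forall_ge_eq {α : Type*} [Preorder α] [WellQuasiOrderedLE α]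
    {E : ℕ → Set α} (hlow : ∀ k p q, p ≤ q → q ∈ E k → p ∈ E k) (hE : Antitone E) :
    ∃ k, ∀ j, k ≤ j → E j = E k := by
  by_contra! h
  have h' : ∀ k, ∃ j, k < j ∧ ∃ p, p ∈ E k ∧ p ∉ E j := by
    intro k
    obtain ⟨j, hkj, hne⟩ := h k
    obtain ⟨p, hp, hp'⟩ := Set.not_subset.mp fun hs => hne ((hE hkj).antisymm hs)
    refine ⟨j, lt_of_le_of_ne hkj ?_, p, hp, hp'⟩
    rintro rfl
    exact hne rfl
  choose f hf p hp hp' using h'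
  have hmono : StrictMono fun n => f^[n] 0 := by
    refine strictMono_nat_of_lt_succ fun n => ?_
    rw [Function.iterate_succ_apply']
    exact hf _
  obtain ⟨m, n, hmn, hle⟩ := wellQuasiOrdered_le fun n => p (f^[n] 0)
  refine hp' (f^[m] 0) (hlow _ _ _ hle (hE ?_ (hp (f^[n] 0))))
  rw [← Function.iterate_succ_apply' f]
  exact hmono.monotone hmn

end

/-! ### Regions and minimal bad sequences. -/

section

open Filter

variable {A : Type*}

/-- The sequence `x` of subforests arises from `z` by removing the contexts `c`; before time `m`
the subforest is empty, and `z` lives in the context alone. -/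
structure IsRegion (K : Set (ForestContext A)) (c : ℕ → ForestContext A) (m : ℕ)
    (x z : ℕ → Forest A) : Prop where
  before : ∀ n < m, x n = 0 ∧ z n ≤ c m • (0 : Forest A)
  eq : ∀ n, m ≤ n → z n = c n • x n
  mem : ∀ n, m ≤ n → c n ∈ K
  mono : ∀ n n', m ≤ n → n ≤ n' → c n ≤ c n'

/-- A monotone sequence in `S` whose types are not eventually constant. -/
structure IsBad (L : Set (Forest A)) (S : Set (Forest A)) (x : ℕ → Forest A) : Prop where
  mono : Monotone x
  mem : ∀ n, x n ∈ S
  not_const : ¬ EventuallyConstType L x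

namespace IsRegion

variable {L : Set (Forest A)} {ω : ℕ} {K : Set (ForestContext A)} {S : Set (Forest A)}
  {c d : ℕ → ForestContext A} {m m' : ℕ} {x y z : ℕ → Forest A}

protected theorem refl (hK : IsAbsorbing L ω K S) (x : ℕ → Forest A) : IsRegion K 1 0 x x where
  before n hn := absurd hn (Nat.not_lt_zero n)
  eq n _ := (one_smul _ (x n)).symm
  mem _ _ := hK.one_mem
  mono _ _ _ _ := le_rfl

theorem size_le (h : IsRegion K c m x z) (n : ℕ) : (x n).size ≤ (z n).size := by
  rcases lt_or_ge n m with hn | hn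
  · simp [(h.before n hn).1]
  · rw [h.eq n hn, ForestContext.size_smul]
    exact Nat.le_add_left _ _

theorem eq_of_size_le (h : IsRegion K c m x z) {n : ℕ} (hn : (z n).size ≤ (x n).size) :
    x n = z n := by
  rcases lt_or_ge n m with hm | hm
  · rw [(h.before n hm).1] at hn ⊢
    exact (Forest.size_eq_zero.mp (Nat.le_zero.mp hn)).symm
  · rw [h.eq n hm] at hn ⊢
    rw [ForestContext.eq_one_of_size hn, one_smul]

/-- If the subforest is empty at time `n`, then the forest at time `n` embeds in the context at
any later time. -/
theorem le_of_eq_zero (hK : IsAbsorbing L ω K S) (h : IsRegion K c m x z) {n n' : ℕ}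
    (hx : x n = 0) (hn : n ≤ n') (hm : m ≤ n') : z n ≤ c n' • (0 : Forest A) := by
  rcases lt_or_ge n m with hn' | hn'
  · exact (h.before n hn').2.trans
      (hK.smul_mono (h.mono m n' le_rfl hm) (h.mem n' hm) hK.zero_mem)
  · rw [h.eq n hn', hx]
    exact hK.smul_mono (h.mono n n' hn' hn) (h.mem n' hm) hK.zero_mem

protected theorem trans (hK : IsAbsorbing L ω K S) (hx : IsRegion K c m x z)
    (hy : IsRegion K d m' y x) (hxS : ∀ n, x n ∈ S) :
    IsRegion K (c * d) (max m m') y z where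
  before n hn := by
    have hm := le_max_left m m'
    have hm' := le_max_right m m'
    rw [Pi.mul_apply, mul_smul]
    -- While `y` is empty, all of `z n` must fit into the composed context at the new starting time,
    -- with empty hole.
    have key : ∀ n, y n = 0 → n ≤ max m m' →
        z n ≤ c (max m m') • d (max m m') • (0 : Forest A) := by
      intro n hyn hn
      rcases lt_or_ge n m with h | h
      · exact (hx.before n h).2.trans ((hK.smul_mono (hx.mono m _ le_rfl hm)
          (hx.mem _ hm) hK.zero_mem).trans (ForestContext.smul_le_smul_right _ (Forest.zero_le _)))
      · rw [hx.eq n h]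
        exact (hK.smul_mono (hx.mono n _ h hn) (hx.mem _ hm) (hxS n)).trans
          (ForestContext.smul_le_smul_right _ (hy.le_of_eq_zero hK hyn hn hm'))
    have hyn : y n = 0 := by
      rcases lt_or_ge n m' with h | h
      · exact (hy.before n h).1
      · have h' : n < m := by
          rcases lt_max_iff.mp hn with h' | h'
          · exact h'
          · exact absurd h' (not_lt.mpr h)
        have := hy.size_le n
        rw [(hx.before n h').1] at this
        exact Forest.size_eq_zero.mp (Nat.le_zero.mp this)
    exact ⟨hyn, key n hyn hn.le⟩
  eq n hn := by
    rw [hx.eq n ((le_max_left _ _).trans hn), hy.eq n ((le_max_right _ _).trans hn), Pi.mul_apply,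
      mul_smul]
  mem n hn := hK.mul_mem (hx.mem n ((le_max_left _ _).trans hn))
    (hy.mem n ((le_max_right _ _).trans hn))
  mono n n' hn hn' := hK.mul_mono (hx.mono n n' ((le_max_left _ _).trans hn) hn')
    (hy.mono n n' ((le_max_right _ _).trans hn) hn')
    (hx.mem n' ((le_max_left _ _).trans (hn.trans hn')))
    (hy.mem n' ((le_max_right _ _).trans (hn.trans hn')))

end IsRegion

/-- `C k * C (k + 1) * ⋯ * C (k + m - 1)`. -/
def chainProd {M : Type*} [Monoid M] (C : ℕ → M) (k : ℕ) : ℕ → M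
  | 0 => 1
  | m + 1 => chainProd C k m * C (k + m)

theorem chainProd_add {M : Type*} [Monoid M] (C : ℕ → M) (k m m' : ℕ) :
    chainProd C k (m + m') = chainProd C k m * chainProd C (k + m) m' := by
  induction m' with
  | zero => simp [chainProd]
  | succ m' ih => rw [← add_assoc, chainProd, ih, chainProd, mul_assoc, add_assoc]

/-- The maximum of `M k, …, M (k + m - 1)`. -/
def chainMax (M : ℕ → ℕ) (k : ℕ) : ℕ → ℕ
  | 0 => 0
  | m + 1 => max (chainMax M k m) (M (k + m))

theorem chainMax_le {M : ℕ → ℕ} {k m n : ℕ} : chainMax M k m ≤ n ↔ ∀ i < m, M (k + i) ≤ n := by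
  induction m with
  | zero => simp [chainMax]
  | succ m ih => rw [chainMax, max_le_iff, ih, Nat.forall_lt_succ_right]

/-- A descending sequence of regions, each minimising its size at one more time among the bad
subregions of its predecessor. -/
theorem IsBad.exists_greedy {L : Set (Forest A)} {K : Set (ForestContext A)} {S : Set (Forest A)}
    {ω : ℕ} (hK : IsAbsorbing L ω K S) {x : ℕ → Forest A} (hx : IsBad L S x) :
    ∃ X : ℕ → ℕ → Forest A, X 0 = x ∧ (∀ k, IsBad L S (X k)) ∧
      (∀ k, ∃ c m, IsRegion K c m (X (k + 1)) (X k)) ∧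
      ∀ k z c m, IsBad L S z → IsRegion K c m z (X k) → (X (k + 1) k).size ≤ (z k).size := by
  have step : ∀ (k : ℕ) (x : {x // IsBad L S x}), ∃ y : {y // IsBad L S y},
      (∃ c m, IsRegion K c m y.1 x.1) ∧
      ∀ z c m, IsBad L S z → IsRegion K c m z x.1 → (y.1 k).size ≤ (z k).size := by
    intro k x
    obtain ⟨y, ⟨hy, hyx⟩, hmin⟩ := (measure fun y : ℕ → Forest A => (y k).size).wf.has_min
      {y : ℕ → Forest A | IsBad L S y ∧ ∃ c m, IsRegion K c m y x.1}
      ⟨x.1, x.2, 1, 0, .refl hK _⟩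
    exact ⟨⟨y, hy⟩, hyx, fun z c m hz hzx => not_lt.mp (hmin z ⟨hz, c, m, hzx⟩)⟩
  choose f hf hmin using step
  let X : ℕ → {x // IsBad L S x} := fun k => Nat.rec ⟨x, hx⟩ (fun k y => f k y) k
  exact ⟨fun k => (X k).1, rfl, fun k => (X k).2, fun k => hf k (X k),
    fun k z c m hz hzk => hmin k (X k) z c m hz hzk⟩

/-- At each fixed time the sizes decrease with `k`, and once they are constant the removed contexts
are trivial. Here `κ n` is a stage after which time `n` no longer changes. -/
theorem exists_limit_of_region {K : Set (ForestContext A)} {X : ℕ → ℕ → Forest A}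
    (hX : ∀ k, ∃ c m, IsRegion K c m (X (k + 1)) (X k)) :
    ∃ (κ : ℕ → ℕ) (y : ℕ → Forest A), ∀ n k, κ n ≤ k → X k n = y n := by
  have h : ∀ n, ∃ j, ∀ k, j ≤ k → X k n = X j n := by
    intro n
    have hanti : Antitone fun k => (X k n).size := antitone_nat_of_succ_le fun k => by
      obtain ⟨c, m, h⟩ := hX k
      exact h.size_le n
    obtain ⟨j, hj⟩ := WellFoundedLT.antitone_chain_condition hanti
    refine ⟨j, fun k hk => ?_⟩
    induction k, hk using Nat.le_induction with
    | base => rfl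
    | succ k hk ih =>
      obtain ⟨c, m, h⟩ := hX k
      have h1 : (X j n).size = (X k n).size := hj k hk
      have h2 : (X j n).size = (X (k + 1) n).size := hj (k + 1) (hk.trans k.le_succ)
      rw [h.eq_of_size_le (h1.symm.trans h2).le, ih]
  choose κ hκ using h
  exact ⟨κ, fun n => X (κ n) n, hκ⟩

section Descent

variable {L : Set (Forest A)} {ω : ℕ} {K : Set (ForestContext A)} {S : Set (Forest A)}
  {X : ℕ → ℕ → Forest A} {C : ℕ → ℕ → ForestContext A} {M : ℕ → ℕ}
  {κ : ℕ → ℕ} {y : ℕ → Forest A}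

theorem isRegion_chainProd (hK : IsAbsorbing L ω K S) (hX : ∀ k n, X k n ∈ S)
    (hreg : ∀ k, IsRegion K (C k) (M k) (X (k + 1)) (X k)) (k m : ℕ) :
    IsRegion K (chainProd C k m) (chainMax M k m) (X (k + m)) (X k) := by
  induction m with
  | zero => exact .refl hK _
  | succ m ih => exact ih.trans hK (hreg (k + m)) (hX _)

/-- Before its starting time a region is empty, and it stays empty at all later stages. So one time
with nonempty limit bounds all starting times. -/
theorem le_of_limit_ne_zero (hreg : ∀ k, IsRegion K (C k) (M k) (X (k + 1)) (X k))
    (hy : ∀ n k, κ n ≤ k → X k n = y n) {n : ℕ} (hn : y n ≠ 0) (k : ℕ) : M k ≤ n := by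
  by_contra! h
  have h0 : X (k + 1) n = 0 := ((hreg k).before n h).1
  have : ∀ j, X (k + 1 + j) n = 0 := by
    intro j
    induction j with
    | zero => exact h0
    | succ j ih =>
      have := (hreg (k + 1 + j)).size_le n
      rw [ih] at this
      exact Forest.size_eq_zero.mp (Nat.le_zero.mp this)
  exact hn ((hy n (k + 1 + κ n) (Nat.le_add_left _ _)).symm.trans (this _))

theorem chainProd_eq_of_le (hreg : ∀ k, IsRegion K (C k) (M k) (X (k + 1)) (X k))
    (hy : ∀ n k, κ n ≤ k → X k n = y n) {n : ℕ} (hn : y n ≠ 0) (k : ℕ) {j : ℕ}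
    (hj : κ n ≤ j) : chainProd C k j n = chainProd C k (κ n) n := by
  induction j, hj using Nat.le_induction with
  | base => rfl
  | succ j hj ih =>
    have h := (hreg (k + j)).eq n (le_of_limit_ne_zero hreg hy hn _)
    rw [hy n (k + j) (by omega), hy n (k + j + 1) (by omega)] at h
    rw [chainProd, Pi.mul_apply, ih, ForestContext.eq_one_of_size (congrArg Forest.size h).ge,
      mul_one]

/-- At time `n` only the factors before `κ n` differ from `1`, so the infinite product of removed
contexts is a finite one. Any two times can be compared at a common finite stage. -/
theorem isRegion_limit (hK : IsAbsorbing L ω K S) (hX : ∀ k n, X k n ∈ S)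
    (hreg : ∀ k, IsRegion K (C k) (M k) (X (k + 1)) (X k))
    (hy : ∀ n k, κ n ≤ k → X k n = y n) {m : ℕ} (hm : ∀ n, y n ≠ 0 ↔ m ≤ n) (k : ℕ) :
    IsRegion K (fun n => chainProd C k (κ n) n) m y (X k) := by
  have hmax : ∀ n, m ≤ n → ∀ j, chainMax M k j ≤ n := fun n hn j =>
    chainMax_le.mpr fun i _ => le_of_limit_ne_zero hreg hy ((hm n).mpr hn) _
  have hprod := isRegion_chainProd hK hX hreg k
  have hle : ∀ n, m ≤ n → ∀ j, κ n ≤ j → chainProd C k j n = chainProd C k (κ n) n :=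
    fun n hn j => chainProd_eq_of_le hreg hy ((hm n).mpr hn) k
  refine ⟨fun n hn => ?_, fun n hn => ?_, fun n hn => ?_, fun n n' hn hn' => ?_⟩
  · have hyn : y n = 0 := by
      by_contra h
      exact absurd ((hm n).mp h) (not_le.mpr hn)
    refine ⟨hyn, ?_⟩
    have h := (hprod (max (κ n) (κ m))).le_of_eq_zero hK
      ((hy n (k + max (κ n) (κ m)) (by omega)).trans hyn) hn.le (hmax m le_rfl _)
    rwa [hle m le_rfl _ (le_max_right _ _)] at h
  · rw [(hprod (κ n)).eq n (hmax n hn _), hy n _ (Nat.le_add_left _ _)]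
  · exact (hprod (κ n)).mem n (hmax n hn _)
  · rw [← hle n hn _ (le_max_left _ (κ n')), ← hle n' (hn.trans hn') _ (le_max_right (κ n) _)]
    exact (hprod _).mono n n' (hmax n hn _) hn'

theorem EventuallyConstType.congr {x z : ℕ → Forest A} (hz : EventuallyConstType L z)
    (h : ∀ᶠ n in atTop, forestType L (x n) = forestType L (z n)) : EventuallyConstType L x := by
  obtain ⟨t, ht⟩ := hz
  exact ⟨t, by filter_upwards [h, ht] with n h1 h2 using h1.trans h2⟩

theorem EventuallyConstType.smul {x : ℕ → Forest A} (hx : EventuallyConstType L x)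
    (p : ForestContext A) : EventuallyConstType L fun n => p • x n := by
  obtain ⟨t, ht⟩ := hx
  exact ⟨contextType L p • t, by
    filter_upwards [ht] with n hn
    rw [← contextType_smul_forestType, hn]⟩

theorem eventuallyConstType_of_eventually_eq {x : ℕ → Forest A} {s : Forest A}
    (h : ∀ᶠ n in atTop, x n = s) : EventuallyConstType L x :=
  ⟨forestType L s, by filter_upwards [h] with n hn; rw [hn]⟩

theorem exists_ne_zero_iff_le {x : ℕ → Forest A} (hmono : Monotone x)
    (hx : ¬ EventuallyConstType L x) : ∃ m, ∀ n, x n ≠ 0 ↔ m ≤ n := by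
  classical
  have h : ∃ m, x m ≠ 0 := by
    by_contra! h
    exact hx (eventuallyConstType_of_eventually_eq (.of_forall h))
  refine ⟨Nat.find h, fun n => ⟨fun hn => Nat.find_min' h hn, fun hn hn' => ?_⟩⟩
  exact Nat.find_spec h (Forest.le_zero.mp ((hmono hn).trans_eq hn'))

/-- In a descending sequence of regions with a limit whose types are eventually constant, some
region has eventually constant types. -/
theorem exists_eventuallyConstType [Finite A] [Finite (SynH L)] [Finite (SynV L)]
    (hK : IsAbsorbing L ω K S) (hX : ∀ k n, X k n ∈ S)
    (hreg : ∀ k, IsRegion K (C k) (M k) (X (k + 1)) (X k))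
    (hy : ∀ n k, κ n ≤ k → X k n = y n) (hmono : Monotone y) (hconst : EventuallyConstType L y) :
    ∃ k, EventuallyConstType L (X k) := by
  have hprod := isRegion_chainProd hK hX hreg
  -- The contexts that embed in what is removed between stage `k` and some later stage, at an
  -- admissible time.
  let E : ℕ → Set (ForestContext A) := fun k =>
    {p | ∃ m n, chainMax M k m ≤ n ∧ p ≤ chainProd C k m n}
  have hlow : ∀ k p q, p ≤ q → q ∈ E k → p ∈ E k := by
    rintro k p q hpq ⟨m, n, hn, hq⟩
    exact ⟨m, n, hn, hpq.trans hq⟩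
  have hanti : Antitone E := by
    refine antitone_nat_of_succ_le fun k => ?_
    rintro p ⟨m, n, hn, hp⟩
    rw [chainMax_le] at hn
    refine ⟨1 + m, max n (M k), ?_, hp.trans ?_⟩
    · rw [chainMax_le]
      rintro (_ | i) hi
      · exact le_max_right _ _
      · have := hn i (by omega)
        rw [show k + (i + 1) = k + 1 + i by ring]
        exact this.trans (le_max_left _ _)
    · have h1 : chainMax M (k + 1) m ≤ max n (M k) := (chainMax_le.mpr hn).trans (le_max_left _ _)
      refine ((hprod (k + 1) m).mono n _ (chainMax_le.mpr hn) (le_max_left n (M k))).trans ?_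
      rw [chainProd_add, Pi.mul_apply]
      have := hK.mul_mono (ForestContext.one_le (chainProd C k 1 (max n (M k))))
        (le_refl (chainProd C (k + 1) m (max n (M k))))
        ((hprod k 1).mem _ (by simp [chainMax])) ((hprod (k + 1) m).mem _ h1)
      simpa using this
  obtain ⟨k, hk⟩ := WellQuasiOrderedLE.exists_forall_ge_eq hlow hanti
  have hE : IsLowerSubmonoid K (E k) := by
    refine ⟨?_, ⟨0, 0, by simp [chainMax], le_rfl⟩, ?_, hlow k _ _⟩
    · rintro p ⟨m, n, hn, hp⟩
      exact hK.lower hp ((hprod k m).mem n hn)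
    · rintro p q ⟨m, n, hn, hp⟩ hq
      -- By stability the second factor may be taken from stage `k + m` on, where the first one
      -- ends, so the two removed products concatenate.
      rw [← hk (k + m) (Nat.le_add_right _ _)] at hq
      obtain ⟨m', n', hn', hq⟩ := hq
      have h1 := hn.trans (le_max_left n n')
      have h2 := hn'.trans (le_max_right n n')
      refine ⟨m + m', max n n', ?_, ?_⟩
      · rw [chainMax_le] at h1 h2 ⊢
        intro i hi
        rcases lt_or_ge i m with h | h
        · exact h1 i h
        · have := h2 (i - m) (by omega)
          rwa [show k + m + (i - m) = k + i by omega] at this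
      · rw [chainProd_add, Pi.mul_apply]
        exact hK.mul_mono (hp.trans ((hprod k m).mono _ _ hn (le_max_left _ _)))
          (hq.trans ((hprod (k + m) m').mono _ _ hn' (le_max_right _ _)))
          ((hprod k m).mem _ h1) ((hprod (k + m) m').mem _ h2)
  obtain ⟨e, q, heE, ⟨m, n₀, hn₀, hq⟩, habs, hrem⟩ := hE.exists_absorbing hK
  have hmem : ∀ j n, chainMax M (k + m) j ≤ n → chainProd C (k + m) j n ∈ E k := by
    intro j n hn
    rw [← hk (k + m) (Nat.le_add_right _ _)]
    exact ⟨j, n, hn, le_rfl⟩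
  -- From time `n₀` on, the context removed between stages `k` and `k + m` lies above `q` and
  -- therefore acts as `e`.
  have htype : ∀ n, n₀ ≤ n → forestType L (X k n) = forestType L (e • X (k + m) n) := by
    intro n hn
    rw [(hprod k m).eq n (hn₀.trans hn)]
    exact habs _ ⟨m, n, hn₀.trans hn, le_rfl⟩ (hq.trans ((hprod k m).mono _ _ hn₀ hn)) _ (hX _ _)
  refine ⟨k, ?_⟩
  by_cases hz : ∃ n₁, y n₁ ≠ 0
  · obtain ⟨n₁, hn₁⟩ := hz
    -- What is removed after stage `k + m` also lies in `E k` and is absorbed by `e`, leaving `e • y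
    -- n`.
    refine (hconst.smul e).congr ?_
    filter_upwards [eventually_ge_atTop n₀, eventually_ge_atTop n₁] with n h0 h1
    have hyn : y n ≠ 0 := fun h => hn₁ (Forest.le_zero.mp (h ▸ hmono h1))
    have hmax : chainMax M (k + m) (κ n) ≤ n :=
      chainMax_le.mpr fun i _ => le_of_limit_ne_zero hreg hy hyn _
    rw [htype n h0, (hprod (k + m) (κ n)).eq n hmax, hrem _ (hmem _ _ hmax) _ (hX _ _),
      hy n _ (Nat.le_add_left _ _)]
  · push Not at hz
    refine ⟨forestType L (e • (0 : Forest A)), ?_⟩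
    filter_upwards [eventually_ge_atTop n₀] with n hn
    have hmax := le_max_right n (chainMax M (k + m) (κ n))
    rw [htype n hn]
    -- The limit is empty, so the forest at stage `k + m` embeds in a context of `E k` with empty
    -- hole.
    exact hK.remainder (hlow k) hrem (hmem _ _ hmax) ((hprod (k + m) (κ n)).mem _ hmax) (hX _ _)
      ((hprod (k + m) (κ n)).le_of_eq_zero hK
        ((hy n _ (Nat.le_add_left _ _)).trans (hz n)) (le_max_left _ _) hmax)

/-- Every bad sequence has a minimal bad region. -/
theorem IsBad.exists_minimal [Finite A] [Finite (SynH L)] [Finite (SynV L)]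
    (hK : IsAbsorbing L ω K S) {x : ℕ → Forest A} (hx : IsBad L S x) :
    ∃ y c m, IsBad L S y ∧ IsRegion K c m y x ∧
      ∀ z c m, IsBad L S z → IsRegion K c m z y → ∀ n, z n = y n := by
  obtain ⟨X, rfl, hbad, hreg, hmin⟩ := hx.exists_greedy hK
  obtain ⟨κ, y, hy⟩ := exists_limit_of_region hreg
  choose C M hreg using hreg
  have hX : ∀ k n, X k n ∈ S := fun k => (hbad k).mem
  have hmono : Monotone y := fun n n' h => by
    rw [← hy n (max (κ n) (κ n')) (le_max_left _ _),
      ← hy n' (max (κ n) (κ n')) (le_max_right _ _)]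
    exact (hbad _).mono h
  have hyconst : ¬ EventuallyConstType L y := fun h => by
    obtain ⟨k, hk⟩ := exists_eventuallyConstType hK hX hreg hy hmono h
    exact (hbad k).not_const hk
  obtain ⟨m, hm⟩ := exists_ne_zero_iff_le hmono hyconst
  have hlim := isRegion_limit hK hX hreg hy hm
  have hyS : ∀ n, y n ∈ S := fun n => hy n _ le_rfl ▸ hX _ n
  refine ⟨y, _, m, ⟨hmono, hyS, hyconst⟩, hlim 0, fun z c m' hz hzy n => ?_⟩
  -- The choice at stage `n` minimised the size at time `n` among the bad regions of `X n`, and `z`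
  -- is one of these. So `z n` is at least as large as `X (n + 1) n`, and hence as `y n`.
  refine hzy.eq_of_size_le (le_trans ?_ (hmin n z _ _ hz ((hlim n).trans hK hzy hyS)))
  exact (hlim (n + 1)).size_le n

end Descent

end

/-! ### The two identities provide absorbing pairs. -/

section

open Filter

section Absorbing

variable {A : Type*} {L : Set (Forest A)} {ω : ℕ}

open Forest ForestContext

theorem ForestContext.hole_pow (l r : Forest A) (n : ℕ) :
    hole l r ^ n = hole (n • l) (n • r) := by
  induction n with
  | zero => simp only [pow_zero, zero_nsmul]; rfl
  | succ n ih => rw [pow_succ, ih, hole_mul_hole, succ_nsmul, succ_nsmul']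

/-- The power of `hole l r` is `hole (ω • l) (ω • r)`, so absorption is the horizontal identity on
either side of the hole. -/
theorem isAbsorbing_hole
    (h : ∀ s t : Forest A, s ≤ t → forestType L (ω • t + s) = forestType L (ω • t) ∧
      forestType L (s + ω • t) = forestType L (ω • t)) :
    IsAbsorbing L ω {p | ∃ l r, p = hole l r} Set.univ where
  one_mem := ⟨0, 0, rfl⟩
  mul_mem := by
    rintro _ _ ⟨l, r, rfl⟩ ⟨l', r', rfl⟩
    exact ⟨_, _, rfl⟩
  lower := by
    rintro p _ hp ⟨l, r, rfl⟩
    cases Emb.of_le hp with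
    | hole_hole _ _ => exact ⟨_, _, rfl⟩
  zero_mem := trivial
  smul_mem _ _ := trivial
  mul_mono := by
    rintro p _ q _ hp hq ⟨l, r, rfl⟩ ⟨l', r', rfl⟩
    cases Emb.of_le hp with
    | hole_hole h1 h2 =>
      cases Emb.of_le hq with
      | hole_hole h3 h4 =>
        exact hole_le_hole.mpr ⟨Forest.add_le_add h1 h3, Forest.add_le_add h4 h2⟩
  smul_mono := by
    rintro p _ s hp ⟨l, r, rfl⟩ -
    cases Emb.of_le hp with
    | hole_hole h1 h2 => exact Forest.add_le_add (Forest.add_le_add h1 le_rfl) h2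
  factor := by
    rintro u _ _ ⟨l, r, rfl⟩ ⟨l', r', rfl⟩ hle
    cases u with
    | node => cases Emb.of_le hle
    | hole l2 r2 =>
      obtain ⟨h1, h2⟩ := hole_le_hole.mp (hole_mul_hole l2 r2 l r ▸ hle)
      obtain ⟨x, x', rfl, hx, hx'⟩ := exists_of_add_le h1
      obtain ⟨y, y', rfl, hy, hy'⟩ := exists_of_add_le h2
      exact ⟨hole x y', hole x' y, rfl, hole_le_hole.mpr ⟨hx, hy'⟩, hole_le_hole.mpr ⟨hx', hy⟩,
        _, _, rfl⟩
  absorb := by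
    rintro p _ s hp ⟨l, r, rfl⟩ -
    cases Emb.of_le hp with
    | @hole_hole l' _ r' _ h1 h2 =>
      have hl := h _ _ h1
      have hr := h _ _ h2
      simp only [forestType_add] at hl hr
      simp only [hole_pow, hole_smul, forestType_add]
      constructor
      · rw [← add_assoc, ← add_assoc, hl.1, add_assoc _ (forestType L r'), hr.2]
      · rw [← add_assoc, ← add_assoc, hl.2, add_assoc _ _ (forestType L r'), hr.1]
  remainder := by
    rintro E e _ s hlow habs hq ⟨l, r, rfl⟩ - hs
    rw [hole_smul, add_zero] at hs
    obtain ⟨x, y, rfl, hx, hy⟩ := exists_of_le_add hs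
    simpa [hole_smul] using habs _ (hlow _ _ (hole_le_hole.mpr ⟨hx, hy⟩) hq) 0 trivial

/-- Induction on `q`, following where `s` embeds. If `s` keeps the root `a`, it is a context of `E`
applied to a part treated by induction or to `0`. If it lies in the tree containing the hole,
induction applies; otherwise it lies beside the path to the hole, which is the case `hside`. -/
theorem isAbsorbing_remainder_tree {E : Set (ForestContext A)} {e : ForestContext A}
    (hlow : ∀ p q, p ≤ q → q ∈ E → p ∈ E)
    (habs : ∀ p ∈ E, ∀ s : Forest A, s.IsTreeOrZero →
      forestType L (e • p • s) = forestType L (e • s))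
    (q : ForestContext A) (a : A) (s : Forest A) (hq : node 0 a q 0 ∈ E) (hs : s.IsTreeOrZero)
    (hle : s ≤ Forest.tree a (q • (0 : Forest A))) :
    forestType L (e • s) = forestType L (e • (0 : Forest A)) := by
  -- The tree `a(s)` arises both by applying `a(□)` to `s` and by applying `a(s + □)` or `a(□ + s)`
  -- to `0`. All of these contexts lie in `E` and are absorbed.
  have hside : ∀ q a (s : Forest A), node 0 a q 0 ∈ E → hole s 0 ≤ q ∨ hole 0 s ≤ q →
      s.IsTreeOrZero → forestType L (e • s) = forestType L (e • (0 : Forest A)) := by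
    intro q a s hq h hs
    have h1 : node 0 a (hole 0 0) 0 ∈ E :=
      hlow _ _ (Emb.node_node a le_rfl (Emb.of_le (one_le q)) le_rfl).le hq
    rw [← habs _ h1 s hs]
    rcases h with h | h
    · rw [← habs _ (hlow _ _ (Emb.node_node a le_rfl (Emb.of_le h) le_rfl).le hq) 0 (Or.inl rfl)]
      simp [node_smul, hole_smul]
    · rw [← habs _ (hlow _ _ (Emb.node_node a le_rfl (Emb.of_le h) le_rfl).le hq) 0 (Or.inl rfl)]
      simp [node_smul, hole_smul]
  induction q generalizing a s with
  | hole l r =>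
    rw [hole_smul, add_zero] at hle
    rcases le_tree_cases hle with rfl | ⟨d, rfl, hd⟩ | ⟨-, hd⟩
    · rfl
    · obtain ⟨x, y, rfl, hx, hy⟩ := exists_of_le_add hd
      have := habs _ (hlow _ _ (Emb.node_node a le_rfl (.hole_hole hx hy) le_rfl).le hq) 0
        (Or.inl rfl)
      simpa [node_smul, hole_smul] using this
    · rcases hs.le_add_cases hd with hd | hd
      · exact hside _ a s hq (Or.inl (hole_le_hole.mpr ⟨hd, Forest.zero_le _⟩)) hs
      · exact hside _ a s hq (Or.inr (hole_le_hole.mpr ⟨Forest.zero_le _, hd⟩)) hs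
  | node l b q r ih =>
    have hb : node 0 b q 0 ∈ E := hlow _ _ (Emb.dig b a le_rfl
      (.node_node b (Forest.zero_le _) (Emb.of_le le_rfl) (Forest.zero_le _)) le_rfl).le hq
    have ih' : ∀ s : Forest A, s.IsTreeOrZero → s ≤ Forest.tree b (q • (0 : Forest A)) →
        forestType L (e • s) = forestType L (e • (0 : Forest A)) := fun s hs hle =>
      ih b s hb hs hle
    rw [node_smul] at hle
    rcases le_tree_cases hle with rfl | ⟨d, rfl, hd⟩ | ⟨-, hd⟩
    · rfl
    · obtain ⟨d', y, rfl, hd, hy⟩ := exists_of_le_add hd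
      obtain ⟨x, z, rfl, hx, hz⟩ := exists_of_le_add hd
      have hz' : z.IsTreeOrZero := .of_le (Or.inr (isTree_tree _ _)) hz
      have := habs _ (hlow _ _ (Emb.node_node a le_rfl (.hole_node b q hx hy) le_rfl).le hq) z hz'
      rw [ih' z hz' hz] at this
      simpa [node_smul, hole_smul] using this
    · rcases hs.le_add_cases hd with hd | hd
      · rcases hs.le_add_cases hd with hd | hd
        · exact hside _ a s hq (Or.inl (Emb.hole_node b q hd (Forest.zero_le _)).le) hs
        · exact ih' s hs hd
      · exact hside _ a s hq (Or.inr (Emb.hole_node b q (Forest.zero_le _) hd).le) hs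

theorem isAbsorbing_tree
    (h : ∀ p q : ForestContext A, p.IsTreeContext → q.IsTreeContext → p ≤ q →
      ∀ s : Forest A, s.IsTreeOrZero →
      forestType L (q ^ ω • p • s) = forestType L (q ^ ω • s) ∧
      forestType L (p • q ^ ω • s) = forestType L (q ^ ω • s)) :
    IsAbsorbing L ω {p | p.IsTreeOrOne} {s | s.IsTreeOrZero} where
  one_mem := Or.inl rfl
  mul_mem hp hq := hp.mul hq
  lower hpq hq := hq.of_le hpq
  zero_mem := Or.inl rfl
  smul_mem hp hs := hp.smul hs
  mul_mono hp hq _ hq' :=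
    (mul_le_mul_left' hp (hq'.of_le hq)).trans (ForestContext.mul_le_mul_right' _ hq)
  smul_mono hpq _ hs := smul_le_smul_left hpq hs
  factor hp _ hle := exists_of_mul_le hp hle
  absorb := by
    intro p q s hpq hq hs
    rcases hq.of_le hpq with rfl | hp
    · simp
    · rcases hq with rfl | hq
      · obtain ⟨a, p, rfl⟩ := hp
        cases Emb.of_le hpq
      · exact h p q hp hq hpq s hs
  remainder := by
    rintro E e q s hlow habs hqE (rfl | ⟨a, q, rfl⟩) hs hle
    · rw [one_smul] at hle
      rw [Forest.le_zero.mp hle]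
    · exact isAbsorbing_remainder_tree hlow habs q a s hqE hs (by simpa [node_smul] using hle)

end Absorbing

end

/-! ### Types along monotone sequences are eventually constant. -/

section

open Filter Forest ForestContext

section Sequences

theorem exists_seq_of_step {α : Type*} {P : ℕ → α → Prop} {R : α → α → Prop} {a : α}
    (h0 : P 0 a) (step : ∀ n a, P n a → ∃ b, P (n + 1) b ∧ R a b) :
    ∃ f : ℕ → α, f 0 = a ∧ ∀ n, P n (f n) ∧ R (f n) (f (n + 1)) := by
  choose g hg hR using step
  let f : ∀ n, {a // P n a} := fun n =>
    Nat.rec ⟨a, h0⟩ (fun n x => ⟨g n x.1 x.2, hg n x.1 x.2⟩) n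
  exact ⟨fun n => (f n).1, rfl, fun n => ⟨(f n).2, hR n _ (f n).2⟩⟩

theorem exists_seq_extend_down {α : Type*} {P : ℕ → α → Prop} {R : α → α → Prop}
    (step : ∀ n b, P (n + 1) b → ∃ a, P n a ∧ R a b) (N : ℕ) (f : ℕ → α)
    (hf : ∀ n, N ≤ n → P n (f n) ∧ R (f n) (f (n + 1))) :
    ∃ g : ℕ → α, (∀ n, N ≤ n → g n = f n) ∧ ∀ n, P n (g n) ∧ R (g n) (g (n + 1)) := by
  induction N generalizing f with
  | zero => exact ⟨f, fun _ _ => rfl, fun n => hf n n.zero_le⟩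
  | succ N ih =>
    obtain ⟨a, ha, hR⟩ := step N _ (hf (N + 1) le_rfl).1
    obtain ⟨g, hg, hg'⟩ := ih (Function.update f N a) (by
      intro n hn
      rcases hn.eq_or_lt with rfl | hn
      · simpa using ⟨ha, hR⟩
      · rw [Function.update_of_ne (by omega), Function.update_of_ne (by omega)]
        exact hf n hn)
    refine ⟨g, fun n hn => ?_, hg'⟩
    rw [hg n (by omega), Function.update_of_ne (by omega)]

variable {A : Type*} {L : Set (Forest A)} {x : ℕ → Forest A}

theorem EventuallyConstType.of_shift (m : ℕ)
    (h : EventuallyConstType L fun n => x (m + n)) : EventuallyConstType L x := by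
  obtain ⟨t, ht⟩ := h
  obtain ⟨N, hN⟩ := eventually_atTop.mp ht
  refine ⟨t, eventually_atTop.mpr ⟨m + N, fun n hn => ?_⟩⟩
  have := hN (n - m) (by omega)
  dsimp only at this
  rwa [Nat.add_sub_cancel' (by omega)] at this

theorem EventuallyConstType.shift (m : ℕ) (h : EventuallyConstType L x) :
    EventuallyConstType L fun n => x (m + n) := by
  obtain ⟨t, ht⟩ := h
  obtain ⟨N, hN⟩ := eventually_atTop.mp ht
  exact ⟨t, eventually_atTop.mpr ⟨N, fun n hn => hN _ (by omega)⟩⟩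

theorem Monotone.exists_add_of_add (hx : Monotone x) {N : ℕ} {s t : Forest A}
    (h : x N = s + t) :
    ∃ y z : ℕ → Forest A, Monotone y ∧ Monotone z ∧ y N = s ∧ z N = t ∧ ∀ n, x n = y n + z n := by
  obtain ⟨f, hf0, hf⟩ := exists_seq_of_step
    (P := fun n (p : Forest A × Forest A) => x (N + n) = p.1 + p.2) (R := (· ≤ ·))
    (a := (s, t)) h fun n p hp => by
      obtain ⟨w1, w2, hw, h1, h2⟩ := exists_of_add_le (hp ▸ hx (Nat.le_succ (N + n)))
      exact ⟨(w1, w2), hw, h1, h2⟩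
  obtain ⟨g, hg, hg'⟩ := exists_seq_extend_down
    (P := fun n (p : Forest A × Forest A) => x n = p.1 + p.2) (R := (· ≤ ·))
    (fun n p hp => by
      obtain ⟨w1, w2, hw, h1, h2⟩ := exists_of_le_add (hp ▸ hx (Nat.le_succ n))
      exact ⟨(w1, w2), hw, h1, h2⟩) N (fun n => f (n - N)) (fun n hn => by
      have := hf (n - N)
      rw [Nat.add_sub_cancel' hn] at this
      rwa [show n + 1 - N = n - N + 1 by omega])
  have hgN : g N = (s, t) := by rw [hg N le_rfl, Nat.sub_self, hf0]
  exact ⟨fun n => (g n).1, fun n => (g n).2, monotone_nat_of_le_succ fun n => (hg' n).2.1,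
    monotone_nat_of_le_succ fun n => (hg' n).2.2, by simp [hgN], by simp [hgN], fun n => (hg' n).1⟩

theorem EventuallyConstType.add {y : ℕ → Forest A} (hx : EventuallyConstType L x)
    (hy : EventuallyConstType L y) : EventuallyConstType L fun n => x n + y n := by
  obtain ⟨s, hs⟩ := hx
  obtain ⟨t, ht⟩ := hy
  exact ⟨s + t, by filter_upwards [hs, ht] with n h1 h2; rw [forestType_add, h1, h2]⟩

end Sequences

section Tail

variable {A : Type*} {x : ℕ → Forest A}

theorem ForestContext.eq_one_of_eq_smul {p : ForestContext A} {s : Forest A} (h : s = p • s) :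
    p = 1 := eq_one_of_size (congrArg Forest.size h).ge

theorem exists_region_of_tail_of_le (N : ℕ) (c : ℕ → ForestContext A) (y : ℕ → Forest A)
    (h : ∀ n, N ≤ n → x n = c n • y n ∧ (y n).IsTree ∧ (c n).IsTreeOrOne)
    (hc : ∀ n, N ≤ n → c n ≤ c (n + 1)) (hy : ∀ n, N ≤ n → y n ≤ y (n + 1))
    (hle : ∀ n < N, x n ≤ c N • (0 : Forest A)) :
    ∃ z d m, Monotone z ∧ (∀ n, (z n).IsTreeOrZero) ∧
      IsRegion {p | p.IsTreeOrOne} d m z x ∧ ∀ n, N ≤ n → m ≤ n ∧ z n = y n ∧ d n = c n := by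
  have hmono : ∀ n n', N ≤ n → n ≤ n' → c n ≤ c n' ∧ y n ≤ y n' := by
    intro n n' hn hn'
    induction n', hn' using Nat.le_induction with
    | base => exact ⟨le_rfl, le_rfl⟩
    | succ n' hn' ih => exact ⟨ih.1.trans (hc n' (hn.trans hn')), ih.2.trans (hy n' (hn.trans hn'))⟩
  refine ⟨fun n => if n < N then 0 else y n, c, N, fun n n' hn => ?_, fun n => ?_,
    ⟨fun n hn => ⟨if_pos hn, hle n hn⟩, fun n hn => ?_, fun n hn => (h n hn).2.2,
      fun n n' hn hn' => (hmono n n' hn hn').1⟩,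
    fun n hn => ⟨hn, if_neg (not_lt.mpr hn), rfl⟩⟩
  · dsimp only
    split_ifs with h1 h2 h2
    · exact le_rfl
    · exact Forest.zero_le _
    · omega
    · exact (hmono n n' (not_lt.mp h1) hn).2
  · dsimp only
    split_ifs with h1
    · exact Or.inl rfl
    · exact Or.inr (h n (not_lt.mp h1)).2.1
  · rw [if_neg (not_lt.mpr hn)]
    exact (h n hn).1

/-- A decomposition from some time on extends to a region. -/
theorem exists_region_of_tail (hx : Monotone x) (N : ℕ)
    (c : ℕ → ForestContext A) (y : ℕ → Forest A)
    (h : ∀ n, N ≤ n → x n = c n • y n ∧ (y n).IsTree ∧ (c n).IsTreeOrOne)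
    (hc : ∀ n, N ≤ n → c n ≤ c (n + 1)) (hy : ∀ n, N ≤ n → y n ≤ y (n + 1)) :
    ∃ z d m, Monotone z ∧ (∀ n, (z n).IsTreeOrZero) ∧
      IsRegion {p | p.IsTreeOrOne} d m z x ∧ ∀ n, N ≤ n → m ≤ n ∧ z n = y n ∧ d n = c n := by
  induction N generalizing c y with
  | zero =>
    exact exists_region_of_tail_of_le 0 c y h hc hy fun n hn => absurd hn n.not_lt_zero
  | succ N ih =>
    obtain ⟨h1, h2, h3⟩ := h (N + 1) le_rfl
    -- Going back one time, either the forest fits into the context alone and the region starts at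
    -- `N + 1`, or the decomposition extends to time `N`.
    rcases exists_of_le_smul (Or.inr h2) (h1 ▸ hx N.le_succ) with hle | ⟨p, s, hps, hp, hs, hst⟩
    · exact exists_region_of_tail_of_le _ c y h hc hy fun n hn =>
        (hx (Nat.le_of_lt_succ hn)).trans hle
    · obtain ⟨z, d, m, hz, hz', hreg, heq⟩ := ih (Function.update c N p)
        (Function.update y N s) (by
          intro n hn
          rcases hn.eq_or_lt with rfl | hn
          · simpa using ⟨hps, hst, h3.of_le hp⟩
          · rw [Function.update_of_ne (by omega), Function.update_of_ne (by omega)]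
            exact h n hn) (by
          intro n hn
          rcases hn.eq_or_lt with rfl | hn
          · simpa using hp
          · rw [Function.update_of_ne (by omega), Function.update_of_ne (by omega)]
            exact hc n hn) (by
          intro n hn
          rcases hn.eq_or_lt with rfl | hn
          · simpa using hs
          · rw [Function.update_of_ne (by omega), Function.update_of_ne (by omega)]
            exact hy n hn)
      refine ⟨z, d, m, hz, hz', hreg, fun n hn => ?_⟩
      have := heq n (by omega)
      rwa [Function.update_of_ne (by omega), Function.update_of_ne (by omega)] at this

end Tail

section Components

variable {A : Type*} [Finite A] {L : Set (Forest A)} {ω : ℕ} [Finite (SynH L)] [Finite (SynV L)]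
  {x : ℕ → Forest A}

/-- A bad sequence of forests has a bad region consisting of trees. -/
theorem IsBad.exists_component
    (hK : IsAbsorbing L ω {p | ∃ l r, p = hole l r} Set.univ) (hx : IsBad L Set.univ x) :
    ∃ y c m, IsBad L {s | s.IsTreeOrZero} y ∧ IsRegion {p | ∃ l r, p = hole l r} c m y x := by
  obtain ⟨y, c, m, hy, hyx, hmin⟩ := hx.exists_minimal hK
  refine ⟨y, c, m, ⟨hy.mono, fun n => ?_, hy.not_const⟩, hyx⟩
  change (y n).IsTreeOrZero
  cases hn : y n with
  | nil => exact Or.inl rfl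
  | cons a d s =>
    -- Split off the first tree at time `n` and extend the splitting to all times. One of the two
    -- parts is bad, and by minimality it is the whole of `y`: it cannot be `v`, which lacks the
    -- first tree at time `n`, and if it is `u` then `y n` is a tree.
    obtain ⟨u, v, hu, hv, hun, hvn, huv⟩ := hy.mono.exists_add_of_add
      (show y n = Forest.tree a d + s from hn)
    by_cases hvc : EventuallyConstType L v
    · have hub : ¬ EventuallyConstType L u := fun h =>
        hy.not_const (funext huv ▸ h.add hvc)
      have := hmin u (fun n => hole 0 (v n)) 0 ⟨hu, fun _ => trivial, hub⟩
        ⟨fun n hn => absurd hn n.not_lt_zero, fun n _ => by simp [hole_smul, huv],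
          fun n _ => ⟨_, _, rfl⟩, fun n n' _ h => hole_le_hole.mpr ⟨le_rfl, hv h⟩⟩ n
      rw [hun, hn] at this
      exact Or.inr ⟨a, d, this.symm⟩
    · have := hmin v (fun n => hole (u n) 0) 0 ⟨hv, fun _ => trivial, hvc⟩
        ⟨fun n hn => absurd hn n.not_lt_zero, fun n _ => by simp [hole_smul, huv],
          fun n _ => ⟨_, _, rfl⟩, fun n n' _ h => hole_le_hole.mpr ⟨hu h, le_rfl⟩⟩ n
      have h1 := huv n
      rw [this, hun] at h1
      have h2 := congrArg Forest.size h1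
      simp at h2

/-- The root persists in a minimal bad sequence of trees only up to some time. -/
theorem IsBad.false_of_root
    (hH : IsAbsorbing L ω {p | ∃ l r, p = hole l r} Set.univ)
    (hx : IsBad L {s | s.IsTreeOrZero} x)
    (hmin : ∀ z c m, IsBad L {s | s.IsTreeOrZero} z →
      IsRegion {p | p.IsTreeOrOne} c m z x → ∀ n, z n = x n)
    {N : ℕ} {a : A} {y : ℕ → Forest A} (hy : Monotone y)
    (hxy : ∀ n, x (N + n) = Forest.tree a (y n)) : False := by
  have htree : ∀ p : ForestContext A, ∀ s : Forest A,
      Forest.tree a (p • s) = node 0 a p 0 • s := fun p s => by simp [node_smul]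
  have hyb : IsBad L Set.univ y := by
    refine ⟨hy, fun _ => trivial, fun h => hx.not_const (.of_shift N ((h.smul
      (node 0 a 1 0)).congr (.of_forall fun n => ?_)))⟩
    rw [hxy, ← htree, one_smul]
  -- A bad component of the forests of children, together with the root `a`, gives a bad region of
  -- `x` whose context is never trivial.
  obtain ⟨z, c, m, hz, hreg⟩ := hyb.exists_component hH
  obtain ⟨m', hm'⟩ := exists_ne_zero_iff_le hz.mono hz.not_const
  obtain ⟨w, d, m₁, hw, hw', hreg', heq⟩ := exists_region_of_tail hx.mono (N + max m m')
    (fun n => node 0 a (c (n - N)) 0) (fun n => z (n - N)) (by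
      intro n hn
      refine ⟨?_, (hz.mem (n - N)).resolve_left ((hm' _).mpr (by omega)), isTreeOrOne_node _ _⟩
      have := hxy (n - N)
      rw [Nat.add_sub_cancel' (by omega)] at this
      rw [this, hreg.eq (n - N) (by omega), htree]) (by
      intro n hn
      exact (Emb.node_node a le_rfl
        (Emb.of_le (hreg.mono _ _ (by omega) (by omega))) le_rfl).le) (by
      intro n hn
      exact hz.mono (by omega))
  have hwb : IsBad L {s | s.IsTreeOrZero} w := by
    refine ⟨hw, hw', fun h => hz.not_const (.of_shift (max m m') ?_)⟩
    refine (h.shift (N + max m m')).congr (.of_forall fun n => ?_)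
    rw [(heq _ (by omega)).2.1, show N + max m m' + n - N = max m m' + n by omega]
  have h1 := hmin w d m₁ hwb hreg' (N + max m m')
  obtain ⟨h2, h3, h4⟩ := heq _ le_rfl
  have h5 := hreg'.eq _ h2
  rw [← h1] at h5
  have := eq_one_of_eq_smul h5
  rw [h4] at this
  cases this

/-- In a minimal bad sequence of trees, it cannot happen at infinitely many times that the tree
is pushed below a new root. -/
theorem IsBad.false_of_push
    (hK : IsAbsorbing L ω {p | p.IsTreeOrOne} {s | s.IsTreeOrZero})
    (hx : IsBad L {s | s.IsTreeOrZero} x)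
    (hmin : ∀ z c m, IsBad L {s | s.IsTreeOrZero} z →
      IsRegion {p | p.IsTreeOrOne} c m z x → ∀ n, z n = x n)
    (hpush : ∀ N, ∃ n a d, N ≤ n ∧ x (n + 1) = Forest.tree a d ∧ x n ≤ d) : False := by
  obtain ⟨n₁, hn₁⟩ := exists_ne_zero_iff_le hx.mono hx.not_const
  have htree : ∀ n, n₁ ≤ n → (x n).IsTree := fun n hn => (hx.mem n).resolve_left ((hn₁ n).mpr hn)
  -- The contexts that the sequence can acquire above `x m`. Once `Q` is stable, an acquired context
  -- can be acquired again above later members, so `Q k` is closed under products.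
  let Q : ℕ → Set (ForestContext A) := fun m => {p | p.IsTreeOrOne ∧ ∃ n, p • x m ≤ x n}
  obtain ⟨m₀, hm₀⟩ := WellQuasiOrderedLE.exists_forall_ge_eq (E := Q)
    (fun k p q hpq ⟨hq, n, hn⟩ =>
      ⟨hq.of_le hpq, n, (smul_le_smul_left hpq (hx.mem k)).trans hn⟩)
    (fun m m' hm p ⟨hp, n, hn⟩ => ⟨hp, n, (smul_le_smul_right p (hx.mono hm)).trans hn⟩)
  obtain ⟨k, a, d, hk, hxk, hkd⟩ := hpush (max n₁ m₀)
  have hkm : m₀ ≤ k := (le_max_right _ _).trans hk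
  have hkn : n₁ ≤ k := (le_max_left _ _).trans hk
  have hE : IsLowerSubmonoid {p : ForestContext A | p.IsTreeOrOne} (Q k) := by
    refine ⟨fun p hp => hp.1, ⟨Or.inl rfl, k, by rw [one_smul]⟩, ?_, ?_⟩
    · rintro p q hp ⟨hq, n, hn⟩
      refine ⟨hp.1.mul hq, ?_⟩
      rw [hm₀ k hkm, ← hm₀ (max n m₀) (le_max_right _ _)] at hp
      obtain ⟨-, n', hn'⟩ := hp
      exact ⟨n', mul_smul p q (x k) ▸ (smul_le_smul_right p
        (hn.trans (hx.mono (le_max_left _ _)))).trans hn'⟩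
    · rintro p q hpq ⟨hq, n, hn⟩
      exact ⟨hq.of_le hpq, n, (smul_le_smul_left hpq (hx.mem k)).trans hn⟩
  obtain ⟨e, q, -, hq, habs, -⟩ := hE.exists_absorbing hK
  have hb : node 0 a 1 0 ∈ Q k := by
    refine ⟨isTreeOrOne_node _ _, k + 1, ?_⟩
    rw [hxk, node_smul, one_smul, zero_add, add_zero]
    exact tree_le_tree a hkd
  -- The factor `q` makes the peeled-off context act as `e`, and the extra root makes it nontrivial,
  -- as needed for the contradiction with minimality.
  obtain ⟨-, n, hn⟩ := hE.mul_mem hq hb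
  obtain ⟨p, s, hps, hqp, hks, hs⟩ := exists_of_smul_le (htree k hkn)
    (hn.trans (hx.mono (le_max_left n k)))
  set N := max n k
  have hNk : k ≤ N := le_max_right n k
  obtain ⟨f, hf0, hf⟩ := exists_seq_of_step
    (P := fun j (c : ForestContext A × Forest A) => x (N + j) = c.1 • c.2 ∧ c.2.IsTree)
    (R := (· ≤ ·)) (a := (p, s)) ⟨hps, hs⟩ fun j c hc => by
      obtain ⟨p', s', h, h1, h2, h3⟩ := exists_of_smul_le hc.2
        (hc.1 ▸ hx.mono (Nat.le_succ (N + j)))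
      exact ⟨(p', s'), ⟨h, h3⟩, h1, h2⟩
  obtain ⟨w, c, m, hw, hw', hreg, heq⟩ := exists_region_of_tail hx.mono N
    (fun j => (f (j - N)).1) (fun j => (f (j - N)).2) (by
      intro j hj
      have := (hf (j - N)).1
      rw [Nat.add_sub_cancel' hj] at this
      exact ⟨this.1, this.2, isTreeOrOne_of_smul this.2.ne_zero (this.1 ▸ hx.mem j)⟩) (by
      intro j hj
      rw [show j + 1 - N = j - N + 1 by omega]
      exact (hf (j - N)).2.1) (by
      intro j hj
      rw [show j + 1 - N = j - N + 1 by omega]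
      exact (hf (j - N)).2.2)
  have hwN := heq N le_rfl
  rw [Nat.sub_self, hf0] at hwN
  by_cases hwc : EventuallyConstType L w
  · refine hx.not_const ((hwc.smul e).congr ?_)
    filter_upwards [eventually_ge_atTop N] with j hj
    have hcj : p ≤ c j := hwN.2.2.ge.trans (hreg.mono N j hwN.1 hj)
    have hsj : x k ≤ w j := hks.trans (hwN.2.1.ge.trans (hw hj))
    rw [hreg.eq j (heq j hj).1]
    refine habs _ ⟨hreg.mem j (heq j hj).1, j, ?_⟩
      ((ForestContext.le_mul_right q _).trans (hqp.trans hcj)) _ (hw' j)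
    exact (smul_le_smul_right _ hsj).trans (hreg.eq j (heq j hj).1).ge
  · have h1 := hmin w c m ⟨hw, hw', hwc⟩ hreg N
    rw [hwN.2.1, hps] at h1
    obtain rfl := eq_one_of_eq_smul h1
    have h2 := (le_mul_left (isTreeOrOne_node a 1) q).trans hqp
    cases Emb.of_le h2

/-- The types along a monotone sequence of forests are eventually constant. -/
theorem eventuallyConstType_of_monotone
    (hH : IsAbsorbing L ω {p | ∃ l r, p = hole l r} Set.univ)
    (hK : IsAbsorbing L ω {p | p.IsTreeOrOne} {s | s.IsTreeOrZero}) (hx : Monotone x) :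
    EventuallyConstType L x := by
  by_contra hc
  obtain ⟨z, -, -, hz, -⟩ := IsBad.exists_component hH ⟨hx, fun _ => trivial, hc⟩
  obtain ⟨y, -, -, hy, -, hmin⟩ := hz.exists_minimal hK
  by_cases hpush : ∀ N, ∃ n a d, N ≤ n ∧ y (n + 1) = Forest.tree a d ∧ y n ≤ d
  · exact hy.false_of_push hK hmin hpush
  push Not at hpush
  obtain ⟨N₀, hN₀⟩ := hpush
  obtain ⟨n₁, hn₁⟩ := exists_ne_zero_iff_le hy.mono hy.not_const
  set N := max N₀ n₁
  obtain ⟨a, d, had⟩ : (y N).IsTree :=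
    (hy.mem N).resolve_left ((hn₁ N).mpr (le_max_right _ _))
  -- Once pushes have stopped, every embedding maps root to root: the label `a` persists and the
  -- forests of children grow.
  obtain ⟨f, hf0, hf⟩ := exists_seq_of_step
    (P := fun j d => y (N + j) = Forest.tree a d) (R := (· ≤ ·)) (a := d) had fun j d hd => by
      obtain ⟨b, d', hb⟩ : (y (N + (j + 1))).IsTree :=
        (hy.mem _).resolve_left ((hn₁ _).mpr ((le_max_right N₀ n₁).trans (Nat.le_add_right _ _)))
      have hle := hy.mono (Nat.le_succ (N + j))
      rw [show (N + j).succ = N + (j + 1) from rfl, hb] at hle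
      rcases le_tree_cases hle with h | ⟨e, he, hed⟩ | ⟨-, h⟩
      · rw [hd] at h
        exact absurd h (tree_ne_zero _ _)
      · obtain ⟨rfl, rfl, -⟩ := (cons.injEq ..).mp (hd.symm.trans he)
        exact ⟨d', hb, hed⟩
      · exact absurd h (hN₀ _ _ _ ((le_max_left N₀ n₁).trans (Nat.le_add_right _ _)) hb)
  exact hy.false_of_root hH hmin (monotone_nat_of_le_succ fun n => (hf n).2) fun n => (hf n).1

end Components

end

/-! ### From stable types to testability, and finiteness lemmas. -/

section

open Filter Forest ForestContext

section Testable

variable {A : Type*} {L : Set (Forest A)}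

theorem forestType_eq_iff {s t : Forest A} : forestType L s = forestType L t ↔ SynRel L s t :=
  (synAddCon L).eq

theorem mem_iff_of_forestType_eq {s t : Forest A} (h : forestType L s = forestType L t) :
    s ∈ L ↔ t ∈ L := by
  simpa using forestType_eq_iff.mp h 1

/-- Failure of testability at every `n` gives `s n ∈ L` and `t n ∉ L` with the same pieces of size
at most `n`. After both are made monotone along a common subsequence, they can be interleaved into
one monotone sequence that leaves and enters `L` forever. -/
theorem isCcaPiecewiseTestable_of_eventuallyConstType [Finite A]
    (h : ∀ x : ℕ → Forest A, Monotone x → EventuallyConstType L x) :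
    IsCcaPiecewiseTestable L := by
  by_contra hL
  have hst : ∀ n : ℕ, ∃ s t : Forest A, s ∈ L ∧ t ∉ L ∧ ∀ r : Forest A, r.size ≤ n →
      (r ≤ s ↔ r ≤ t) := by
    intro n
    by_contra! hn
    refine hL ⟨n + 1, n.succ_pos, fun s t hst => ?_⟩
    have hst' : ∀ r : Forest A, r.size ≤ n → (r ≤ s ↔ r ≤ t) := by
      intro r hr
      have := Set.ext_iff.mp hst r
      simpa [hr.trans n.le_succ, ccaPiece_iff_le] using this
    constructor
    · intro hs
      by_contra ht
      obtain ⟨r, hr, h'⟩ := hn s t hs ht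
      have := hst' r hr
      tauto
    · intro ht
      by_contra hs
      obtain ⟨r, hr, h'⟩ := hn t s ht hs
      have := hst' r hr
      tauto
  choose s t hs ht hst using hst
  obtain ⟨f, hf⟩ := wellQuasiOrdered_le.exists_monotone_subseq s
  obtain ⟨g, hg⟩ := wellQuasiOrdered_le.exists_monotone_subseq (t ∘ f)
  have hs' : Monotone fun n => s (f (g n)) := fun m n hmn => hf _ _ (g.monotone hmn)
  have ht' : Monotone fun n => t (f (g n)) := fun m n hmn => hg _ _ hmn
  have hle : ∀ n, n ≤ f (g n) := fun n => (g.strictMono.le_apply).trans f.strictMono.le_apply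
  -- The next index is at least the sizes of the current forests. So each of these is itself a piece
  -- small enough to pass from `s` to `t`, or back, at that index.
  let k : ℕ → ℕ := fun n => Nat.rec 0
    (fun _ i => max i (max (s (f (g i))).size (t (f (g i))).size)) n
  have hk : ∀ n, k (n + 1) = max (k n) (max (s (f (g (k n)))).size (t (f (g (k n)))).size) :=
    fun _ => rfl
  let x : ℕ → Forest A := fun n => if Even n then s (f (g (k n))) else t (f (g (k n)))
  have hx : Monotone x := by
    refine monotone_nat_of_le_succ fun n => ?_
    have h1 : k n ≤ k (n + 1) := by rw [hk]; exact le_max_left _ _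
    have h2 := hle (k (n + 1))
    have h3 := hk n
    by_cases hn : Even n
    · have hn' : ¬ Even (n + 1) := by simpa [Nat.even_add_one] using hn
      simp only [x, if_pos hn, if_neg hn']
      exact (hst _ _ (by omega)).mp (hs' h1)
    · have hn' : Even (n + 1) := by simpa [Nat.even_add_one] using hn
      simp only [x, if_neg hn, if_pos hn']
      exact (hst _ _ (by omega)).mpr (ht' h1)
  obtain ⟨θ, hθ⟩ := h x hx
  obtain ⟨N, hN⟩ := eventually_atTop.mp hθ
  have hmem := mem_iff_of_forestType_eq
    ((hN (2 * N) (by omega)).trans (hN (2 * N + 1) (by omega)).symm)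
  have h1 : Even (2 * N) := even_two_mul N
  have h2 : ¬ Even (2 * N + 1) := by simp
  simp only [x, if_pos h1, if_neg h2] at hmem
  exact ht _ (hmem.mp (hs _))

theorem isCcaPiecewiseTestable_of_identities [Finite A] [Finite (SynH L)] [Finite (SynV L)]
    {ω : ℕ}
    (hV : ∀ u v : SynV L, IsTreeContextType L u → IsTreeContextType L v →
      ContextTypeCcaPiece L v u → ∀ h : SynH L, (IsTreeType L h ∨ h = 0) →
      u ^ ω • h = u ^ ω • v • h ∧ u ^ ω • v • h = v • u ^ ω • h)
    (hH : ∀ g h : SynH L, TypeCcaPiece L g h →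
      ω • h = ω • h + g ∧ ω • h + g = g + ω • h) :
    IsCcaPiecewiseTestable L := by
  refine isCcaPiecewiseTestable_of_eventuallyConstType fun x hx =>
    eventuallyConstType_of_monotone (ω := ω) (isAbsorbing_hole ?_) (isAbsorbing_tree ?_) hx
  · intro s t hst
    obtain ⟨h1, h2⟩ := hH _ _ ⟨s, t, ccaPiece_iff_le.mpr hst, rfl, rfl⟩
    simp only [forestType_add, forestType_nsmul]
    exact ⟨h1.symm, h2.symm.trans h1.symm⟩
  · intro p q hp hq hpq s hs
    have hs' : IsTreeType L (forestType L s) ∨ forestType L s = 0 := by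
      rcases hs with rfl | hs
      · exact Or.inr rfl
      · exact Or.inl ⟨s, hs, rfl⟩
    obtain ⟨h1, h2⟩ := hV _ _ ⟨q, hq, rfl⟩ ⟨p, hp, rfl⟩
      ⟨p, q, contextCcaPiece_iff_le.mpr hpq, rfl, rfl⟩ _ hs'
    simp only [← contextType_smul_forestType, contextType_pow]
    exact ⟨h1.symm, h2.symm.trans h1.symm⟩

/-- The part of a piece of `p s` that lies in `s`. -/
theorem ForestContext.exists_piece_of_le_smul {p : ForestContext A} {r s : Forest A}
    (h : r ≤ p • s) :
    ∃ r' ≤ s, r'.size ≤ r.size ∧ ∀ s', r' ≤ s' → r ≤ p • s' := by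
  induction p generalizing r with
  | hole l r0 =>
    obtain ⟨w, c, rfl, hw, hc⟩ := exists_of_le_add h
    obtain ⟨a, b, rfl, ha, hb⟩ := exists_of_le_add hw
    exact ⟨b, hb, by simp only [size_add]; omega,
      fun s' hs' => add_le_add (add_le_add ha hs') hc⟩
  | node l a p r0 ih =>
    obtain ⟨w, c, rfl, hw, hc⟩ := exists_of_le_add h
    obtain ⟨v, b, rfl, hv, hb⟩ := exists_of_le_add hw
    rcases le_tree_cases hb with rfl | ⟨d, rfl, hd⟩ | ⟨hbt, hb⟩
    · exact ⟨0, zero_le _, Nat.zero_le _,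
        fun s' _ => add_le_add (add_le_add hv (zero_le _)) hc⟩
    · obtain ⟨r', h1, h2, h3⟩ := ih hd
      exact ⟨r', h1, by simp only [size_add, size_tree]; omega,
        fun s' hs' => add_le_add (add_le_add hv (tree_le_tree a (h3 s' hs'))) hc⟩
    · obtain ⟨r', h1, h2, h3⟩ := ih hb
      exact ⟨r', h1, by simp only [size_add]; omega,
        fun s' hs' => add_le_add (add_le_add hv
          (IsTreeOrZero.le_tree (Or.inr hbt) a (h3 s' hs'))) hc⟩

theorem Forest.finite_size_le [Finite A] (n : ℕ) : {s : Forest A | s.size ≤ n}.Finite := by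
  induction n with
  | zero =>
    refine (Set.finite_singleton (0 : Forest A)).subset fun s hs => ?_
    exact size_eq_zero.mp (Nat.le_zero.mp hs)
  | succ n ih =>
    refine (((Set.finite_univ (α := A)).prod (ih.prod ih)).image
      (fun x => cons x.1 x.2.1 x.2.2) |>.insert 0).subset fun s hs => ?_
    cases s with
    | nil => exact Or.inl rfl
    | cons a c s =>
      have hs' : 1 + c.size + s.size ≤ n + 1 := hs
      exact Or.inr ⟨(a, c, s), ⟨trivial, show c.size ≤ n by omega, show s.size ≤ n by omega⟩, rfl⟩

theorem exists_idempotent_exponent (M : Type*) [Monoid M] [Finite M] :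
    ∃ n : ℕ, 0 < n ∧ ∀ x : M, x ^ n * x ^ n = x ^ n := by
  have := Fintype.ofFinite M
  -- The factorial is a multiple of every period `j - i` and exceeds or equals every preperiod, so
  -- one exponent serves all elements.
  refine ⟨(Fintype.card M).factorial, Nat.factorial_pos _, fun x => ?_⟩
  obtain ⟨i, j, hij, hx⟩ : ∃ i j : Fin (Fintype.card M + 1), i < j ∧ x ^ (i : ℕ) = x ^ (j : ℕ) := by
    obtain ⟨i, j, hne, hh⟩ := Fintype.exists_ne_map_eq_of_card_lt
      (fun i : Fin (Fintype.card M + 1) => x ^ (i : ℕ)) (by simp)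
    rcases lt_or_gt_of_ne hne with h | h
    · exact ⟨i, j, h, hh⟩
    · exact ⟨j, i, h, hh.symm⟩
  have hij' : (i : ℕ) < j := hij
  have hj := j.2
  have hstep : ∀ m k : ℕ, (i : ℕ) ≤ k → x ^ (k + m * (j - i)) = x ^ k := by
    intro m k hk
    induction m with
    | zero => simp
    | succ m ih =>
      rw [show k + (m + 1) * (j - i : ℕ) = (k - i + m * (j - i)) + j by
        rw [Nat.succ_mul]; omega, pow_add, ← hx, ← pow_add, ← ih]
      congr 1
      omega
  obtain ⟨m, hm⟩ : (j - i : ℕ) ∣ (Fintype.card M).factorial :=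
    Nat.dvd_factorial (by omega) (by omega)
  have := hstep m _ ((show (i : ℕ) ≤ Fintype.card M by omega).trans (Nat.self_le_factorial _))
  rwa [mul_comm, ← hm, pow_add] at this

end Testable

end

/-! ### From testability to the identities. -/

section

open Filter Forest ForestContext

section Pieces

variable {A : Type*} {L : Set (Forest A)} {n : ℕ}

/-- `SynV L` acts faithfully on `SynH L`. -/
theorem finite_synV [Finite (SynH L)] : Finite (SynV L) := by
  refine Finite.of_injective (fun (v : SynV L) (h : SynH L) => v • h) ?_
  rintro ⟨p⟩ ⟨q⟩ h
  exact (synCon L).eq.mpr fun s => forestType_eq_iff.mp (congrFun h (forestType L s))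

/-- Membership in `L` depends only on the pieces with at most `n` nodes. -/
def IsDeterminedByPieces (L : Set (Forest A)) (n : ℕ) : Prop :=
  ∀ s t : Forest A, (∀ r : Forest A, r.size ≤ n → (r ≤ s ↔ r ≤ t)) → (s ∈ L ↔ t ∈ L)

namespace IsDeterminedByPieces

/-- A small piece of `p • s` uses only a small piece of `s`, so forests with the same small pieces
remain indistinguishable in every context. -/
theorem forestType_eq (hL : IsDeterminedByPieces L n) {s t : Forest A}
    (h : ∀ r : Forest A, r.size ≤ n → (r ≤ s ↔ r ≤ t)) : forestType L s = forestType L t := by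
  refine forestType_eq_iff.mpr fun p => hL _ _ fun r hr => ⟨fun hs => ?_, fun ht => ?_⟩
  · obtain ⟨r', h1, h2, h3⟩ := exists_piece_of_le_smul hs
    exact h3 t ((h r' (h2.trans hr)).mp h1)
  · obtain ⟨r', h1, h2, h3⟩ := exists_piece_of_le_smul ht
    exact h3 s ((h r' (h2.trans hr)).mpr h1)

theorem finite_synH [Finite A] (hL : IsDeterminedByPieces L n) : Finite (SynH L) := by
  have := (finite_size_le (A := A) n).to_subtype
  refine Finite.of_injective
    (fun h : SynH L => {r : {r : Forest A | r.size ≤ n} | r.1 ≤ Quotient.out h}) fun g h hgh => ?_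
  have key : forestType L (Quotient.out g) = forestType L (Quotient.out h) :=
    hL.forestType_eq fun r hr => Set.ext_iff.mp hgh ⟨r, hr⟩
  exact (Quotient.out_eq g).symm.trans (key.trans (Quotient.out_eq h))

/-- Along a monotone sequence the type is eventually constant, also for forests in between. -/
theorem exists_forall_forestType_eq [Finite A] (hL : IsDeterminedByPieces L n) {x : ℕ → Forest A}
    (hx : Monotone x) :
    ∃ N, ∀ i j y, N ≤ i → x i ≤ y → y ≤ x j → forestType L y = forestType L (x N) := by
  have := (finite_size_le (A := A) n).to_subtype
  -- The sets of small pieces form an increasing chain in a finite power set.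
  obtain ⟨N, hN⟩ := WellFoundedGT.monotone_chain_condition
    (⟨fun m => {r : {r : Forest A | r.size ≤ n} | r.1 ≤ x m},
      fun _ _ h _ hr => le_trans hr (hx h)⟩ : ℕ →o Set {r : Forest A | r.size ≤ n})
  refine ⟨N, fun i j y hi h1 h2 => hL.forestType_eq fun r hr => ⟨fun h => ?_, fun h => ?_⟩⟩
  · have := Set.ext_iff.mp (hN (max N j) (le_max_left _ _)) ⟨r, hr⟩
    exact this.mpr ((h.trans h2).trans (hx (le_max_right _ _)))
  · exact h.trans ((hx hi).trans h1)

variable {ω : ℕ}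

theorem nsmul_add_eq [Finite A] (hL : IsDeterminedByPieces L n) (hω : IsIdempotentExponent L ω)
    {s t : Forest A} (h : s ≤ t) :
    ω • forestType L t + forestType L s = ω • forestType L t ∧
      forestType L s + ω • forestType L t = ω • forestType L t := by
  obtain ⟨N, hN⟩ := hL.exists_forall_forestType_eq (x := fun k => k • t)
    (monotone_nat_of_le_succ fun k => by
      rw [succ_nsmul]
      exact le_add_right _ _)
  have hpow : ∀ k : ℕ, ((k + 1) * ω) • forestType L t = ω • forestType L t := by
    intro k
    induction k with
    | zero => simp
    | succ k ih => rw [Nat.succ_mul, add_nsmul, ih, hω.2.2]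
  -- A multiple of `ω` past the point of stabilisation; multiples by it have the same types as
  -- `ω`-multiples.
  have hle : N ≤ (N + 1) * ω := by nlinarith [hω.1]
  have h0 := hN ((N + 1) * ω) ((N + 1) * ω) _ hle le_rfl le_rfl
  have h1 := hN ((N + 1) * ω) ((N + 1) * ω + 1) (((N + 1) * ω) • t + s) hle (le_add_right _ _)
    (by simp only [succ_nsmul]; exact add_le_add le_rfl h)
  have h2 := hN ((N + 1) * ω) ((N + 1) * ω + 1) (s + ((N + 1) * ω) • t) hle (le_add_left _ _)
    (by simp only [succ_nsmul']; exact add_le_add h le_rfl)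
  simp only [forestType_add, forestType_nsmul, hpow] at h0 h1 h2
  exact ⟨h1.trans h0.symm, h2.trans h0.symm⟩

theorem pow_mul_eq (hω : IsIdempotentExponent L ω) (v : SynV L) (k : ℕ) :
    v ^ ((k + 1) * ω) = v ^ ω := by
  induction k with
  | zero => simp
  | succ k ih => rw [Nat.succ_mul, pow_add, ih, hω.2.1]

theorem pow_smul_smul_eq [Finite A] (hL : IsDeterminedByPieces L n)
    (hω : IsIdempotentExponent L ω) {p q : ForestContext A} (h : p ≤ q) {s : Forest A}
    (hs : s.IsTreeOrZero) :
    contextType L q ^ ω • contextType L p • forestType L s =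
      contextType L q ^ ω • forestType L s := by
  obtain ⟨N, hN⟩ := hL.exists_forall_forestType_eq (x := fun k => q ^ k • s)
    (monotone_nat_of_le_succ fun k => by
      rw [pow_succ, mul_smul]
      exact smul_le_smul_right _ (le_smul hs q))
  have hle : N ≤ (N + 1) * ω := by nlinarith [hω.1]
  have h0 := hN ((N + 1) * ω) ((N + 1) * ω) _ hle le_rfl le_rfl
  have h1 := hN ((N + 1) * ω) ((N + 1) * ω + 1) (q ^ ((N + 1) * ω) • p • s) hle
    (smul_le_smul_right _ (le_smul hs p))
    (by
      simp only [pow_succ, mul_smul]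
      exact smul_le_smul_right _ (smul_le_smul_left h hs))
  simp only [← contextType_smul_forestType, contextType_pow, pow_mul_eq hω] at h0 h1
  exact h1.trans h0.symm

/-- The context `q` witnessing `w ≤ q` need not be a tree-context, so its powers on `s` may fail to
be trees. Inserting the tree-context `q'` of the same type repairs this, and `q' * q` has the same
`ω`-power type as `q`. The sandwich is `x k ≤ w • x k ≤ x (k + 1)` for `x k = (q' * q) ^ k • s`. -/
theorem smul_pow_smul_eq_of_isTreeOrOne [Finite A] (hL : IsDeterminedByPieces L n)
    (hω : IsIdempotentExponent L ω) {w q q' : ForestContext A} (hw : w.IsTreeOrOne) (h : w ≤ q)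
    (hq' : q'.IsTreeContext) (hqq' : contextType L q' = contextType L q) {s : Forest A}
    (hs : s.IsTreeOrZero) :
    contextType L w • contextType L q ^ ω • forestType L s =
      contextType L q ^ ω • forestType L s := by
  have hmem : ∀ k : ℕ, ((q' * q) ^ k • s).IsTreeOrZero := by
    intro k
    cases k with
    | zero => simpa using hs
    | succ k =>
      obtain ⟨a, d, rfl⟩ := hq'
      rw [pow_succ', mul_smul, mul_smul]
      exact Or.inr (isTree_node_smul _ _ _)
  have hle : ∀ k : ℕ, w • (q' * q) ^ k • s ≤ (q' * q) ^ (k + 1) • s := by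
    intro k
    rw [pow_succ', mul_smul, mul_smul]
    exact (le_smul (hw.smul (hmem k)) q').trans
      (smul_le_smul_right _ (smul_le_smul_left h (hmem k)))
  obtain ⟨N, hN⟩ := hL.exists_forall_forestType_eq (x := fun k => (q' * q) ^ k • s)
    (monotone_nat_of_le_succ fun k => (le_smul (hmem k) w).trans (hle k))
  have hN' : N ≤ (N + 1) * ω := by nlinarith [hω.1]
  have h0 := hN ((N + 1) * ω) ((N + 1) * ω) _ hN' le_rfl le_rfl
  have h1 := hN ((N + 1) * ω) ((N + 1) * ω + 1) _ hN' (le_smul (hmem _) w) (hle _)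
  simp only [← contextType_smul_forestType, contextType_pow, contextType_mul, pow_mul_eq hω, hqq',
    (Commute.refl (contextType L q)).mul_pow, hω.2.1] at h0 h1
  exact h1.trans h0.symm

end IsDeterminedByPieces

/-- A pair of contexts `p ≤ q` splits into the forests to the left and to the right of the tree
with the hole, and this tree. -/
theorem ForestContext.exists_eq_surround_of_le {p q : ForestContext A} (h : p ≤ q) :
    ∃ l l' r r' c d, p = surround l c r ∧ q = surround l' d r' ∧ l ≤ l' ∧ r ≤ r' ∧
      c.IsTreeOrOne ∧ d.IsTreeOrOne := by
  cases Emb.of_le h with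
  | @hole_hole l l' r r' hl hr =>
    exact ⟨l, l', r, r', 1, 1, by simp [surround], by simp [surround], hl, hr,
      Or.inl rfl, Or.inl rfl⟩
  | @hole_node b q l l' r r' hl hr =>
    exact ⟨l, l', r, r', 1, node 0 b q 0, by simp [surround], by simp [surround], hl, hr,
      Or.inl rfl, isTreeOrOne_node _ _⟩
  | @node_node a l l' r r' p q hl _ hr =>
    exact ⟨l, l', r, r', node 0 a p 0, node 0 a q 0, by simp [surround], by simp [surround], hl, hr,
      isTreeOrOne_node _ _, isTreeOrOne_node _ _⟩
  | @dig a b l l' r r' p q hl _ hr =>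
    exact ⟨l, l', r, r', node 0 a p 0, node 0 b q 0, by simp [surround], by simp [surround], hl, hr,
      isTreeOrOne_node _ _, isTreeOrOne_node _ _⟩

theorem ForestContext.le_surround (l r : Forest A) (p : ForestContext A) : p ≤ surround l p r := by
  rw [le_iff_markHole_le, markHole_surround]
  exact (le_add_left _ _).trans (le_add_right _ _)

theorem contextType_surround_smul (l r : Forest A) (p : ForestContext A) (h : SynH L) :
    contextType L (surround l p r) • h = forestType L l + contextType L p • h + forestType L r := by
  obtain ⟨s⟩ := h
  exact congrArg (forestType L) (surround_fill l r s p)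

theorem nsmul_add_add_nsmul {M : Type*} [AddMonoid M] {x y z : M} (h : x + y + z = y) (k : ℕ) :
    k • x + y + k • z = y := by
  induction k with
  | zero => simp
  | succ k ih =>
    rw [succ_nsmul, succ_nsmul', ← add_assoc, add_assoc (k • x) x y, add_assoc (k • x) (x + y) z,
      h, ih]

/-- Write `p = l + c + r` and `q = l' + d + r'`. Both `q` and `d` fix the type `θ`, so `l' + θ + r'
= θ` in types. Iterating `ω` times surrounds `θ` by `ω`-multiples of `l'` and `r'`, which absorb `l`
and `r`, while `c` fixes `θ` as well. -/
theorem IsDeterminedByPieces.smul_pow_smul_eq [Finite A] {ω : ℕ} (hL : IsDeterminedByPieces L n)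
    (hω : IsIdempotentExponent L ω) {p q q' : ForestContext A} (h : p ≤ q)
    (hq' : q'.IsTreeContext) (hqq' : contextType L q' = contextType L q) {s : Forest A}
    (hs : s.IsTreeOrZero) :
    contextType L p • contextType L q ^ ω • forestType L s =
      contextType L q ^ ω • forestType L s := by
  obtain ⟨l, l', r, r', c, d, hp, hq, hl, hr, hc, hd⟩ := exists_eq_surround_of_le h
  have hcq : c ≤ q := (hp ▸ le_surround l r c : c ≤ p).trans h
  have hdq : d ≤ q := hq ▸ le_surround l' r' d
  have h1 := hL.smul_pow_smul_eq_of_isTreeOrOne hω hc hcq hq' hqq' hs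
  have h2 := hL.smul_pow_smul_eq_of_isTreeOrOne hω hd hdq hq' hqq' hs
  have h3 : contextType L q • contextType L q ^ ω • forestType L s =
      contextType L q ^ ω • forestType L s := by
    rw [← mul_smul, ← pow_succ', pow_succ, mul_smul]
    exact hL.pow_smul_smul_eq hω le_rfl hs
  set θ := contextType L q ^ ω • forestType L s
  have h4 : forestType L l' + θ + forestType L r' = θ := by
    rw [hq, contextType_surround_smul, h2] at h3
    exact h3
  have h5 := nsmul_add_add_nsmul h4 ω
  rw [hp, contextType_surround_smul, h1]
  calc forestType L l + θ + forestType L r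
      = (forestType L l + ω • forestType L l') + θ +
          (ω • forestType L r' + forestType L r) := by
        conv_lhs => rw [← h5]
        simp only [add_assoc]
    _ = θ := by rw [(hL.nsmul_add_eq hω hl).2, (hL.nsmul_add_eq hω hr).1, h5]

theorem exists_isIdempotentExponent [Finite (SynH L)] [Finite (SynV L)] :
    ∃ ω, IsIdempotentExponent L ω := by
  -- The product monoid yields one exponent for both monoids.
  obtain ⟨ω, h0, hω⟩ := exists_idempotent_exponent (SynV L × Multiplicative (SynH L))
  exact ⟨ω, h0, fun v => congrArg Prod.fst (hω (v, 1)),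
    fun h => congrArg (fun x => x.2.toAdd) (hω (1, Multiplicative.ofAdd h))⟩

theorem IsCcaPiecewiseTestable.exists_isDeterminedByPieces (hL : IsCcaPiecewiseTestable L) :
    ∃ n, IsDeterminedByPieces L n := by
  obtain ⟨n, -, hn⟩ := hL
  refine ⟨n, fun s t hst => hn s t (Set.ext fun r => and_congr_right fun hr => ?_)⟩
  rw [ccaPiece_iff_le, ccaPiece_iff_le]
  exact hst r hr

end Pieces

end

/-! ### The characterisation. -/

theorem mainTheorem4 {A : Type*} [Finite A] (L : Set (Forest A)) :
    IsCcaPiecewiseTestable L ↔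
      Finite (SynH L) ∧ Finite (SynV L) ∧
      ∃ ω : ℕ, IsIdempotentExponent L ω ∧
        (∀ u v : SynV L, IsTreeContextType L u → IsTreeContextType L v →
          ContextTypeCcaPiece L v u →
          ∀ h : SynH L, (IsTreeType L h ∨ h = 0) →
            u ^ ω • h = u ^ ω • v • h ∧ u ^ ω • v • h = v • u ^ ω • h) ∧
        (∀ g h : SynH L, TypeCcaPiece L g h →
          ω • h = ω • h + g ∧ ω • h + g = g + ω • h) := by
  constructor
  · intro h
    obtain ⟨n, hL⟩ := h.exists_isDeterminedByPieces
    have hH : Finite (SynH L) := hL.finite_synH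
    have hV : Finite (SynV L) := finite_synV
    obtain ⟨ω, hω⟩ := exists_isIdempotentExponent (L := L)
    refine ⟨hH, hV, ω, hω, ?_, ?_⟩
    -- The tree-context `q'` of type `u` and the context `q` witnessing `v ⊴ u` may be different
    -- representatives.
    · rintro u v ⟨q', hq', hu⟩ - ⟨p, q, hpq, rfl, rfl⟩ h hh
      rw [ForestContext.contextCcaPiece_iff_le] at hpq
      obtain ⟨s, hs, rfl⟩ : ∃ s : Forest A, s.IsTreeOrZero ∧ forestType L s = h := by
        rcases hh with ⟨s, hs, rfl⟩ | rfl
        · exact ⟨s, Or.inr hs, rfl⟩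
        · exact ⟨0, Or.inl rfl, rfl⟩
      rw [hL.pow_smul_smul_eq hω hpq hs, hL.smul_pow_smul_eq hω hpq hq' hu hs]
      exact ⟨rfl, rfl⟩
    · rintro _ _ ⟨s, t, hst, rfl, rfl⟩
      obtain ⟨h1, h2⟩ := hL.nsmul_add_eq hω (ccaPiece_iff_le.mp hst)
      rw [h1, h2]
      exact ⟨rfl, rfl⟩
  · rintro ⟨hH, hV, ω, -, h1, h2⟩
    exact isCcaPiecewiseTestable_of_identities h1 h2
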